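/- **Conventions.** Let $E$ be a finite set. An oriented matroid $\mathcal M=(E,\mathcal C^*)$ is given by its set $\mathcal C^*\subseteq\{+1,-1,0\}^E$ of signed cocircuits, satisfying the usual cocircuit axioms. Its covectors are the compositions of cocircuits (including the empty composition $0$), ordered by $Y\le X$ iff $Y_e\in\{0,X_e\}$ for all $e$; the rank $r$ is the length of a longest chain $0<X_1<\dots<X_r$ of covectors. $\mathcal M$ is *uniform* if every cocircuit vanishes on exactly $r-1$ elements (that is, the underlying matroid is uniform), and *acyclic* if the all-positive vector is a covector. A set $A\subseteq E$ is a *face* if some covector is $0$ on $A$ and $+1$ on $E\setminus A$; a face $A$ is an *extreme point* (resp. a *facet*) if the restriction $\mathcal M[A]$ has rank $1$ (resp. $r-1$). $\mathcal M$ is a *matroid polytope* if $\{e\}$ is an extreme point for every $e\in E$. For $F\subseteq E$, the reorientation ${}_{-F}\mathcal M$ is obtained by reversing the signs of all cocircuits on $F$. A *tope* is a maximal covector, and a tope $T$ is *simplicial* if the poset of covectors $Y\le T$ is isomorphic to the lattice of subsets of an $r$-element set. **Theorem** (Las Vergnas' conjecture for uniform matroid polytopes of rank 4). Let $\mathcal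 M$ be a uniform matroid polytope of rank $4$ on a finite set $E$. Then there is a set $F\subseteq E$ such that the reorientation ${}_{-F}\mathcal M$ is acyclic and has exactly four extreme points and exactly four facets; equivalently, the sign vector that is $-1$ on $F$ and $+1$ on $E\setminus F$ is a simplicial tope of $\mathcal M$. -/

import Mathlib

/-- Sign vectors indexed by `E`, i.e. elements of `{+1, -1, 0}^E`. -/
abbrev SignVector (E : Type*) := E → SignType

namespace SignVector

variable {E : Type*}

/-- The zero set `X⁰`. -/
def zeroSet (X : SignVector E) : Set E := {e | X e = 0}

/-- The composition `X ∘ Y` of sign vectors. -/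
def comp (X Y : SignVector E) : SignVector E := fun e => if X e = 0 then Y e else X e

/-- The conformal order on sign vectors: `Y ≤ X` if `Y` arises from `X` by replacing some entries
by `0`. (It is not the pointwise order coming from `-1 < 0 < 1`.) -/
def Conforms (Y X : SignVector E) : Prop := ∀ e, X e = Y e ∨ Y e = 0

open Classical in
/-- The sign vector obtained from `X` by reversing the signs on `F`. -/
noncomputable def reorient (F : Set E) (X : SignVector E) : SignVector E :=
  fun e => if e ∈ F then -X e else X e

open Classical in
/-- The sign vector that is `-1` on `F` and `+1` off `F`. -/
noncomputable def ofNeg (F : Set E) : SignVector E := fun e => if e ∈ F then -1 else 1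

theorem reorient_reorient (F : Set E) (X : SignVector E) : reorient F (reorient F X) = X := by
  funext e
  by_cases h : e ∈ F <;> simp [reorient, h]

theorem reorient_neg (F : Set E) (X : SignVector E) : reorient F (-X) = -reorient F X := by
  funext e
  by_cases h : e ∈ F <;> simp [reorient, h]

theorem zeroSet_reorient (F : Set E) (X : SignVector E) :
    zeroSet (reorient F X) = zeroSet X := by
  ext e
  by_cases h : e ∈ F <;> simp [zeroSet, reorient, h]

/-- `L` contains a strict chain `X₀ < X₁ < ⋯ < Xₖ` in the conformal order, with `X₀ = 0`. -/
def HasChain (L : Set (SignVector E)) (k : ℕ) : Prop :=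
  ∃ c : ℕ → SignVector E, c 0 = 0 ∧ (∀ i ≤ k, c i ∈ L) ∧
    ∀ i < k, Conforms (c i) (c (i + 1)) ∧ c i ≠ c (i + 1)

/-- The length of a longest strict chain `0 < X₁ < ⋯ < Xₖ` in `L`. -/
noncomputable def chainRank (L : Set (SignVector E)) : ℕ := sSup {k | HasChain L k}

/-- On a finite ground set chains have bounded length, so that the supremum in `chainRank` is a
maximum. -/
theorem HasChain.le_card [Finite E] {L : Set (SignVector E)} {k : ℕ} (h : HasChain L k) :
    k ≤ Nat.card E := by
  obtain ⟨c, h0, -, hc⟩ := h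
  have key : ∀ i, i ≤ k → i ≤ ({e | c i e ≠ 0} : Set E).ncard := by
    intro i
    induction i with
    | zero => intro _; exact Nat.zero_le _
    | succ i ih =>
      intro hi
      have h1 := ih (by omega)
      obtain ⟨h2, h3⟩ := hc i (by omega)
      have h4 : ({e | c i e ≠ 0} : Set E) ⊂ {e | c (i + 1) e ≠ 0} := by
        constructor
        · intro e he
          rcases h2 e with h | h
          · simpa [h] using he
          · exact absurd h he
        · intro hsub
          apply h3
          funext e
          rcases h2 e with h | h
          · exact h.symm
          · rw [h]
            by_contra hne
            exact (hsub (fun h' => hne h'.symm) : c i e ≠ 0) h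
      have := Set.ncard_lt_ncard h4 (Set.toFinite _)
      omega
  exact (key k le_rfl).trans (Set.ncard_le_card _)

theorem HasChain.le_chainRank [Finite E] {L : Set (SignVector E)} {k : ℕ} (h : HasChain L k) :
    k ≤ chainRank L :=
  le_csSup ⟨Nat.card E, fun _ hk => hk.le_card⟩ h

end SignVector

/-- An oriented matroid on `E`, given by its signed cocircuits. -/
structure OrientedMatroid (E : Type*) where
  /-- The set of signed cocircuits. -/
  cocircuits : Set (SignVector E)
  zero_notMem : (0 : SignVector E) ∉ cocircuits
  neg_mem : ∀ X ∈ cocircuits, -X ∈ cocircuits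
  eq_or_eq_neg : ∀ X ∈ cocircuits, ∀ Y ∈ cocircuits,
    X.zeroSet ⊆ Y.zeroSet → X = Y ∨ X = -Y
  /-- Cocircuit elimination: if `X ≠ -Y` and `X e = -Y e ≠ 0`, then some cocircuit `Z` has
  `Z e = 0`, `Z⁺ ⊆ X⁺ ∪ Y⁺` and `Z⁻ ⊆ X⁻ ∪ Y⁻`. -/
  elimination : ∀ X ∈ cocircuits, ∀ Y ∈ cocircuits, X ≠ -Y → ∀ e, X e = -Y e → X e ≠ 0 →
    ∃ Z ∈ cocircuits, Z e = 0 ∧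
      (∀ f, Z f = 1 → X f = 1 ∨ Y f = 1) ∧ (∀ f, Z f = -1 → X f = -1 ∨ Y f = -1)

namespace OrientedMatroid

variable {E : Type*}

/-- The covectors: all compositions `X₁ ∘ ⋯ ∘ Xₖ` of cocircuits, and `0` (the case `k = 0`). -/
def covectors (M : OrientedMatroid E) : Set (SignVector E) :=
  {X | ∃ l : List (SignVector E), (∀ Y ∈ l, Y ∈ M.cocircuits) ∧ l.foldr SignVector.comp 0 = X}

/-- The rank: the length `r` of a longest chain `0 < X₁ < ⋯ < Xᵣ` of covectors. -/
noncomputable def rank (M : OrientedMatroid E) : ℕ := SignVector.chainRank M.covectors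

/-- The covectors of the restriction `M[A]`: the restrictions to `A` of the covectors of `M`. -/
def restrictCovectors (M : OrientedMatroid E) (A : Set E) : Set (SignVector A) :=
  (fun X (a : A) => X a) '' M.covectors

/-- The rank of the restriction `M[A]`. -/
noncomputable def rankOn (M : OrientedMatroid E) (A : Set E) : ℕ :=
  SignVector.chainRank (M.restrictCovectors A)

/-- `M` is uniform: its hyperplanes (the zero sets of cocircuits) all have exactly `rank M - 1`
elements, i.e. its underlying matroid is uniform. -/
def IsUniform (M : OrientedMatroid E) : Prop :=
  ∀ X ∈ M.cocircuits, X.zeroSet.ncard + 1 = M.rank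

/-- `M` is acyclic: the all-positive vector is a covector. -/
def IsAcyclic (M : OrientedMatroid E) : Prop := (1 : SignVector E) ∈ M.covectors

/-- `F` is a face: some covector vanishes exactly on `F` and is positive off `F`. -/
def IsFace (M : OrientedMatroid E) (F : Set E) : Prop :=
  ∃ X ∈ M.covectors, ∀ e, (e ∈ F → X e = 0) ∧ (e ∉ F → X e = 1)

/-- An extreme point is a face `F` such that `M[F]` has rank `1`. -/
def IsExtremePoint (M : OrientedMatroid E) (F : Set E) : Prop := M.IsFace F ∧ M.rankOn F = 1

/-- A facet is a face `F` such that `M[F]` has rank `rank M - 1`. -/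
def IsFacet (M : OrientedMatroid E) (F : Set E) : Prop := M.IsFace F ∧ M.rankOn F + 1 = M.rank

/-- `M` is a matroid polytope: every element is an extreme point. -/
def IsMatroidPolytope (M : OrientedMatroid E) : Prop := ∀ e : E, M.IsExtremePoint {e}

/-- A tope is a covector that is maximal in the conformal order. -/
def IsTope (M : OrientedMatroid E) (T : SignVector E) : Prop :=
  T ∈ M.covectors ∧ ∀ X ∈ M.covectors, T.Conforms X → X = T

/-- A tope `T` is simplicial if its face lattice, the poset of all covectors `Y ≤ T`, is that of
a simplex, i.e. is isomorphic to the lattice of subsets of a set with `rank M` elements. -/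
def IsSimplicialTope (M : OrientedMatroid E) (T : SignVector E) : Prop :=
  M.IsTope T ∧
    Nonempty ((fun Y Z : {Y : SignVector E // Y ∈ M.covectors ∧ Y.Conforms T} =>
        Y.1.Conforms Z.1) ≃r
      (fun s t : Finset (Fin M.rank) => s ⊆ t))

/-- The reorientation `₋F M`: the signs of all cocircuits are reversed on `F`. -/
noncomputable def reorient (M : OrientedMatroid E) (F : Set E) : OrientedMatroid E where
  cocircuits := {X | SignVector.reorient F X ∈ M.cocircuits}
  zero_notMem := by
    have h : SignVector.reorient F (0 : SignVector E) = 0 := by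
      funext e
      by_cases h : e ∈ F <;> simp [SignVector.reorient, h]
    simpa [h] using M.zero_notMem
  neg_mem := by
    intro X hX
    simpa [SignVector.reorient_neg] using M.neg_mem _ hX
  eq_or_eq_neg := by
    intro X hX Y hY h
    rcases M.eq_or_eq_neg _ hX _ hY (by simpa [SignVector.zeroSet_reorient] using h) with h | h
    · left
      simpa [SignVector.reorient_reorient] using congrArg (SignVector.reorient F) h
    · right
      simpa [SignVector.reorient_reorient, SignVector.reorient_neg] using
        congrArg (SignVector.reorient F) h
  elimination := by
    intro X hX Y hY hne e he he0
    obtain ⟨Z, hZ, hZe, hp, hn⟩ := M.elimination _ hX _ hY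
      (by
        intro h
        apply hne
        simpa [SignVector.reorient_reorient, SignVector.reorient_neg] using
          congrArg (SignVector.reorient F) h) e
      (by by_cases h : e ∈ F <;> simp [SignVector.reorient, h, he])
      (by by_cases h : e ∈ F <;> simpa [SignVector.reorient, h] using he0)
    refine ⟨SignVector.reorient F Z, by simpa [SignVector.reorient_reorient] using hZ, ?_, ?_, ?_⟩
    · by_cases h : e ∈ F <;> simp [SignVector.reorient, h, hZe]
    · intro f
      have h1 := hp f
      have h2 := hn f
      by_cases h : f ∈ F
      · simp only [SignVector.reorient, h, if_true] at h1 h2 ⊢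
        revert h1 h2
        generalize X f = x; generalize Y f = y; generalize Z f = z
        revert x y z; decide
      · simpa [SignVector.reorient, h] using h1
    · intro f
      have h1 := hp f
      have h2 := hn f
      by_cases h : f ∈ F
      · simp only [SignVector.reorient, h, if_true] at h1 h2 ⊢
        revert h1 h2
        generalize X f = x; generalize Y f = y; generalize Z f = z
        revert x y z; decide
      · simpa [SignVector.reorient, h] using h2

end OrientedMatroid

/-!
The simplex is found next to an element `f` of the polytope, by pushing a hyperplane that separates
`f` from a neighbour `g` towards `f` as far as possible.

In rank four, uniformity means that any three elements span a unique hyperplane, given by a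
cocircuit up to sign (`isUniformFour_of_rank`), and that any five elements support a circuit, which
is orthogonal to all covectors (`IsUniformFour.exists_circuit`). In a matroid polytope no circuit
has four elements on one side (`IsMatroidPolytope.not_separates`), so all circuits are of type
`2|3`.

Some cocircuit is positive off its three zeros, i.e. there is a facet. Given two further elements,
consider the circuit on these five: two elements `f`, `g` of the facet have the same sign in it, so
that the hyperplane through the other three separates `f` from `g`
(`IsUniformFour.exists_separating`). Since `f` and `g` lie on a facet, a hyperplane rotating about
them sweeps over the other elements in a linear order (`IsUniformFour.exists_isSweepOrder`).

Let `a`, `b`, `x` span a hyperplane `X` that separates `f` from `g`. Rotate it about `a` and `b`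
towards `f` until it meets another element `s`. The signs of `X` can only change at elements `m`
passed on the way, where the hyperplane through `a`, `b`, `m` again separates `f` from `g`; and
as all circuits are of type `2|3`, the direction of the sign change at `m` depends only on whether
`m` is between `a` and `b` in the sweep order (`IsSweepOrder.sign_eq`). So, when the sign at `m` is
twisted by the parity of the number of zeros beyond `m`, the rotation changes the sign vector
monotonically in the lexicographic order in which later elements are more significant: such
rotations cannot cycle. A separating hyperplane that is lexicographically extremal therefore meets
no element when it is rotated towards `f` (`IsSweepOrder.no_crossing`). If it is spanned by `a`,
`b`, `c`, then its cocircuit and those of the three hyperplanes through `f` and two of `a`, `b`, `c`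
can be signed to agree at all other elements, and these are the vertices of a simplicial tope
(`IsUniformFour.exists_isSimplexAt`). Here "hyperplane" is used in the language of point
configurations; in the arrangement dual to it, cocircuits are vertices and `a`, `b`, `c`, `f` bound
the simplex.

The covectors below this tope are the sixteen faces of the simplex
(`IsSimplexAt.eq_faceVector`), which yields both the face lattice and, after reorientation, the
extreme points and facets.
-/

namespace OrientedMatroid

variable {E : Type*} {M : OrientedMatroid E}

theorem _root_.SignType.eq_neg_of_ne {s t : SignType} (hs : s ≠ 0) (ht : t ≠ 0) (h : s ≠ t) :
    s = -t := by
  revert s t; decide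

/-! ### Hyperplanes of a uniform oriented matroid of rank four -/

/-- Cocircuit elimination, with the conclusion phrased entrywise. -/
theorem exists_elimination {X Y : SignVector E} (hX : X ∈ M.cocircuits) (hY : Y ∈ M.cocircuits)
    (hne : X ≠ -Y) {e : E} (he : X e = -Y e) (he0 : X e ≠ 0) :
    ∃ Z ∈ M.cocircuits, Z e = 0 ∧ ∀ m, Z m = 0 ∨ Z m = X m ∨ Z m = Y m := by
  obtain ⟨Z, hZ, hZe, hp, hn⟩ := M.elimination X hX Y hY hne e he he0
  refine ⟨Z, hZ, hZe, fun m => ?_⟩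
  have h1 := hp m
  have h2 := hn m
  revert h1 h2
  generalize X m = x; generalize Y m = y; generalize Z m = z
  revert x y z; decide

/-- The flat of a covector is an intersection of hyperplanes. -/
theorem exists_cocircuit_of_covector {X : SignVector E} (hX : X ∈ M.covectors) {e : E}
    (he : X e ≠ 0) : ∃ Y ∈ M.cocircuits, Y e ≠ 0 ∧ ∀ m, X m = 0 → Y m = 0 := by
  obtain ⟨l, hl, rfl⟩ := hX
  induction l with
  | nil => exact absurd rfl he
  | cons Y l ih =>
    by_cases hY : Y e = 0
    · obtain ⟨Z, hZ, hZe, h⟩ := ih (fun Z hZ => hl Z (List.mem_cons_of_mem _ hZ))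
        (by simpa [SignVector.comp, hY] using he)
      refine ⟨Z, hZ, hZe, fun m hm => h m ?_⟩
      by_cases hYm : Y m = 0 <;> simp_all [SignVector.comp]
    · refine ⟨Y, hl Y List.mem_cons_self, hY, fun m hm => ?_⟩
      by_contra hYm
      simp [SignVector.comp, hYm] at hm

theorem exists_cocircuit_conforms {X : SignVector E} (hX : X ∈ M.covectors) (h0 : X ≠ 0) :
    ∃ Y ∈ M.cocircuits, SignVector.Conforms Y X := by
  obtain ⟨l, hl, rfl⟩ := hX
  cases l with
  | nil => exact absurd rfl h0
  | cons Y l =>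
    refine ⟨Y, hl Y List.mem_cons_self, fun m => ?_⟩
    by_cases hYm : Y m = 0 <;> simp [SignVector.comp, hYm]

theorem zero_mem_covectors : (0 : SignVector E) ∈ M.covectors := ⟨[], by simp, rfl⟩

theorem comp_mem_covectors {X Y : SignVector E} (hX : X ∈ M.cocircuits) (hY : Y ∈ M.covectors) :
    SignVector.comp X Y ∈ M.covectors := by
  obtain ⟨l, hl, rfl⟩ := hY
  exact ⟨X :: l, by simpa using ⟨hX, hl⟩, rfl⟩

theorem cocircuits_subset_covectors : M.cocircuits ⊆ M.covectors := by
  intro X hX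
  convert comp_mem_covectors hX zero_mem_covectors
  funext e
  by_cases h : X e = 0 <;> simp [SignVector.comp, h]

variable (M) in
/-- `M` is uniform of rank four, in terms of hyperplanes: the zero sets of cocircuits are precisely
the three-element sets. -/
structure IsUniformFour : Prop where
  ncard_zeroSet : ∀ X ∈ M.cocircuits, X.zeroSet.ncard = 3
  exists_vanishing : ∀ a b c, a ≠ b → ∃ X ∈ M.cocircuits, X a = 0 ∧ X b = 0 ∧ X c = 0

theorem zeroSet_eq_of_ncard {X : SignVector E} (hX : X.zeroSet.ncard = 3)
    {a b c : E} (hab : a ≠ b) (hac : a ≠ c) (hbc : b ≠ c) (ha : X a = 0) (hb : X b = 0)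
    (hc : X c = 0) : X.zeroSet = {a, b, c} := by
  symm
  apply Set.eq_of_subset_of_ncard_le
  · rintro e (rfl | rfl | rfl) <;> assumption
  · rw [hX, Set.ncard_eq_three.2 ⟨a, b, c, hab, hac, hbc, rfl⟩]
  · exact Set.finite_of_ncard_ne_zero (by omega)

theorem ne_zero_of_ncard {X : SignVector E} (hX : X.zeroSet.ncard = 3)
    {a b c d : E} (hab : a ≠ b) (hac : a ≠ c) (hbc : b ≠ c) (ha : X a = 0) (hb : X b = 0)
    (hc : X c = 0) (hda : d ≠ a) (hdb : d ≠ b) (hdc : d ≠ c) : X d ≠ 0 := by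
  intro hd
  have h : d ∈ X.zeroSet := hd
  rw [zeroSet_eq_of_ncard hX hab hac hbc ha hb hc] at h
  simp_all

/-- Rotating a hyperplane about two of its elements: if two different hyperplanes contain `a` and
`b`, then so does one through any given third element. -/
theorem exists_vanishing_of_pair {X Y : SignVector E} (hX : X ∈ M.cocircuits)
    (hY : Y ∈ M.cocircuits) {a b c : E} (hXa : X a = 0) (hXb : X b = 0) (hYa : Y a = 0)
    (hYb : Y b = 0) (hXc : X c = 0) (hYc : Y c ≠ 0) (d : E) :
    ∃ Z ∈ M.cocircuits, Z a = 0 ∧ Z b = 0 ∧ Z d = 0 := by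
  by_cases hXd : X d = 0
  · exact ⟨X, hX, hXa, hXb, hXd⟩
  by_cases hYd : Y d = 0
  · exact ⟨Y, hY, hYa, hYb, hYd⟩
  obtain ⟨Y', hY', hd, hz⟩ : ∃ Y' ∈ M.cocircuits, X d = -Y' d ∧ ∀ m, Y' m = 0 ↔ Y m = 0 := by
    have h : X d = -Y d ∨ X d = Y d := by
      revert hXd hYd
      generalize X d = x; generalize Y d = y
      revert x y; decide
    rcases h with h | h
    · exact ⟨Y, hY, h, fun m => Iff.rfl⟩
    · exact ⟨-Y, M.neg_mem _ hY, by simpa using h, fun m => by simp⟩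
  obtain ⟨Z, hZ, hZd, h⟩ := exists_elimination hX hY' (by
    rintro rfl
    exact hYc ((hz c).1 (by simpa using hXc))) hd hXd
  refine ⟨Z, hZ, ?_, ?_, hZd⟩
  · simpa [hXa, (hz a).2 hYa] using h a
  · simpa [hXb, (hz b).2 hYb] using h b

/-- In rank four, uniformity forces every three-element set to be a hyperplane: a maximal chain of
covectors provides a first few hyperplanes, and elimination moves one element at a time. -/
theorem isUniformFour_of_rank [Finite E] (hrank : M.rank = 4) (huniform : M.IsUniform) :
    M.IsUniformFour := by
  have h3 : ∀ X ∈ M.cocircuits, X.zeroSet.ncard = 3 := fun X hX => by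
    have := huniform X hX
    omega
  refine ⟨h3, ?_⟩
  have hchain : SignVector.HasChain M.covectors 4 := by
    have h : M.rank ∈ {k | SignVector.HasChain M.covectors k} := by
      refine Nat.sSup_mem ⟨0, fun _ => 0, rfl, fun i _ => zero_mem_covectors, fun i hi => ?_⟩
        ⟨Nat.card E, fun k hk => SignVector.HasChain.le_card hk⟩
      omega
    rwa [hrank] at h
  obtain ⟨x, hx0, hxm, hx⟩ := hchain
  have down : ∀ i < 4, ∀ e, x (i + 1) e = 0 → x i e = 0 := by
    intro i hi e he
    rcases (hx i hi).1 e with h | h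
    · rw [← h, he]
    · exact h
  have new : ∀ i < 4, ∃ e, x i e = 0 ∧ x (i + 1) e ≠ 0 := by
    intro i hi
    obtain ⟨e, he⟩ := Function.ne_iff.1 (hx i hi).2
    rcases (hx i hi).1 e with h | h
    · exact absurd h.symm he
    · exact ⟨e, h, fun h' => he (h.trans h'.symm)⟩
  -- The chain yields a flag of flats: `a` in three of them, `b` in two, `c` in one.
  obtain ⟨e, -, he⟩ := new 0 (by omega)
  obtain ⟨c, hc1, hc2⟩ := new 1 (by omega)
  obtain ⟨b, hb2, hb3⟩ := new 2 (by omega)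
  obtain ⟨a, ha3, ha4⟩ := new 3 (by omega)
  have hb1 := down 1 (by omega) b hb2
  have ha2 := down 2 (by omega) a ha3
  have ha1 := down 1 (by omega) a ha2
  obtain ⟨X₁, hX₁, -, h1⟩ := exists_cocircuit_of_covector (hxm 1 (by omega)) he
  obtain ⟨X₂, hX₂, h2c, h2⟩ := exists_cocircuit_of_covector (hxm 2 (by omega)) hc2
  obtain ⟨X₃, hX₃, h3b, h3'⟩ := exists_cocircuit_of_covector (hxm 3 (by omega)) hb3
  obtain ⟨X₄, hX₄, h4a, -⟩ := exists_cocircuit_of_covector (hxm 4 (by omega)) ha4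
  have hab : a ≠ b := by
    rintro rfl
    exact hb3 ha3
  -- All triples through `a` and `b`.
  have H1 := exists_vanishing_of_pair hX₁ hX₂ (h1 a ha1) (h1 b hb1) (h2 a ha2) (h2 b hb2)
    (h1 c hc1) h2c
  obtain ⟨y, hy, hya⟩ : ∃ y ∈ X₃.zeroSet, y ≠ a :=
    Set.exists_ne_of_one_lt_ncard (by rw [h3 _ hX₃]; omega) a
  replace hy : X₃ y = 0 := hy
  have hyb : y ≠ b := by
    rintro rfl
    exact h3b hy
  have H2 : ∀ d, ∃ Z ∈ M.cocircuits, Z a = 0 ∧ Z y = 0 ∧ Z d = 0 := by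
    obtain ⟨Z, hZ, hZa, hZb, hZy⟩ := H1 y
    exact exists_vanishing_of_pair hZ hX₃ hZa hZy (h3' a ha3) hy hZb h3b
  -- All triples through `a`.
  have H3 : ∀ d, a ≠ d → ∀ k, ∃ Z ∈ M.cocircuits, Z a = 0 ∧ Z d = 0 ∧ Z k = 0 := by
    intro d had
    by_cases hdb : d = b
    · subst hdb
      exact H1
    by_cases hdy : d = y
    · subst hdy
      exact H2
    obtain ⟨Z, hZ, hZa, hZb, hZd⟩ := H1 d
    obtain ⟨Z', hZ', hZa', hZy', hZd'⟩ := H2 d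
    exact exists_vanishing_of_pair hZ hZ' hZa hZd hZa' hZd' hZb
      (ne_zero_of_ncard (h3 _ hZ') hya.symm had (Ne.symm hdy) hZa' hZy' hZd' hab.symm hyb.symm
        (Ne.symm hdb))
  obtain ⟨p, hp, q, hq, hpq⟩ : ∃ p ∈ X₄.zeroSet, ∃ q ∈ X₄.zeroSet, p ≠ q :=
    (Set.one_lt_ncard (Set.toFinite _)).1 (by rw [h3 _ hX₄]; omega)
  replace hp : X₄ p = 0 := hp
  replace hq : X₄ q = 0 := hq
  have hap : a ≠ p := by
    rintro rfl
    exact h4a hp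
  have haq : a ≠ q := by
    rintro rfl
    exact h4a hq
  have H4 : ∀ k, ∃ Z ∈ M.cocircuits, Z p = 0 ∧ Z q = 0 ∧ Z k = 0 := by
    obtain ⟨Z, hZ, hZa, hZp, hZq⟩ := H3 p hap q
    exact exists_vanishing_of_pair hZ hX₄ hZp hZq hp hq hZa h4a
  -- All triples through `p`.
  have H5 : ∀ d, p ≠ d → ∀ k, ∃ Z ∈ M.cocircuits, Z p = 0 ∧ Z d = 0 ∧ Z k = 0 := by
    intro d hpd k
    by_cases hda : d = a
    · subst hda
      obtain ⟨Z, hZ, h⟩ := H3 p hap k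
      exact ⟨Z, hZ, h.2.1, h.1, h.2.2⟩
    by_cases hdq : d = q
    · subst hdq
      exact H4 k
    obtain ⟨Z, hZ, hZa, hZp, hZd⟩ := H3 p hap d
    obtain ⟨Z', hZ', hZp', hZq', hZd'⟩ := H4 d
    exact exists_vanishing_of_pair hZ hZ' hZp hZd hZp' hZd' hZa
      (ne_zero_of_ncard (h3 _ hZ') hpq hpd (Ne.symm hdq) hZp' hZq' hZd' hap haq
        (Ne.symm hda)) k
  intro d e k hde
  by_cases hda : d = a
  · subst hda
    exact H3 e hde k
  by_cases hea : e = a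
  · subst hea
    obtain ⟨Z, hZ, h⟩ := H3 d hde.symm k
    exact ⟨Z, hZ, h.2.1, h.1, h.2.2⟩
  by_cases hdp : d = p
  · subst hdp
    exact H5 e hde k
  by_cases hep : e = p
  · subst hep
    obtain ⟨Z, hZ, h⟩ := H5 d hde.symm k
    exact ⟨Z, hZ, h.2.1, h.1, h.2.2⟩
  obtain ⟨Z, hZ, hZa, hZd, hZe⟩ := H3 d (Ne.symm hda) e
  obtain ⟨Z', hZ', hZp', hZd', hZe'⟩ := H5 d (Ne.symm hdp) e
  exact exists_vanishing_of_pair hZ hZ' hZd hZe hZd' hZe' hZa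
    (ne_zero_of_ncard (h3 _ hZ') (Ne.symm hdp) (Ne.symm hep) hde hZp' hZd' hZe' hap
      (Ne.symm hda) (Ne.symm hea)) k

/-! ### Circuits and orthogonality -/

namespace IsUniformFour

theorem ne_zero (hM : M.IsUniformFour) {X : SignVector E} (hX : X ∈ M.cocircuits) {a b c d : E}
    (hab : a ≠ b) (hac : a ≠ c) (hbc : b ≠ c) (ha : X a = 0) (hb : X b = 0) (hc : X c = 0)
    (hda : d ≠ a) (hdb : d ≠ b) (hdc : d ≠ c) : X d ≠ 0 :=
  ne_zero_of_ncard (hM.ncard_zeroSet X hX) hab hac hbc ha hb hc hda hdb hdc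

theorem eq_or_eq_neg (hM : M.IsUniformFour) {X Y : SignVector E} (hX : X ∈ M.cocircuits)
    (hY : Y ∈ M.cocircuits) {a b c : E} (hab : a ≠ b) (hac : a ≠ c) (hbc : b ≠ c)
    (hXa : X a = 0) (hXb : X b = 0) (hXc : X c = 0) (hYa : Y a = 0) (hYb : Y b = 0)
    (hYc : Y c = 0) : X = Y ∨ X = -Y := by
  apply M.eq_or_eq_neg X hX Y hY
  rw [zeroSet_eq_of_ncard (hM.ncard_zeroSet X hX) hab hac hbc hXa hXb hXc,
    zeroSet_eq_of_ncard (hM.ncard_zeroSet Y hY) hab hac hbc hYa hYb hYc]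

/-- The cocircuit vanishing at three given elements, normalized by its sign at a fourth one. -/
theorem exists_normalized (hM : M.IsUniformFour) {a b c d : E} (hab : a ≠ b) (hac : a ≠ c)
    (hbc : b ≠ c) (hda : d ≠ a) (hdb : d ≠ b) (hdc : d ≠ c) :
    ∃ X ∈ M.cocircuits, X a = 0 ∧ X b = 0 ∧ X c = 0 ∧ X d = 1 := by
  obtain ⟨X, hX, ha, hb, hc⟩ := hM.exists_vanishing a b c hab
  have h : X d = 1 ∨ X d = -1 := by
    have := hM.ne_zero hX hab hac hbc ha hb hc hda hdb hdc
    revert this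
    generalize X d = x
    revert x; decide
  rcases h with h | h
  · exact ⟨X, hX, ha, hb, hc, h⟩
  · exact ⟨-X, M.neg_mem X hX, by simp [ha], by simp [hb], by simp [hc], by simp [h]⟩

theorem exists_zero_iff_mem (hM : M.IsUniformFour) {T : Finset E} (hT : T.card = 3) :
    ∃ X ∈ M.cocircuits, ∀ e, X e = 0 ↔ e ∈ T := by
  classical
  obtain ⟨a, b, c, hab, hac, hbc, rfl⟩ := Finset.card_eq_three.1 hT
  obtain ⟨X, hX, ha, hb, hc⟩ := hM.exists_vanishing a b c hab
  refine ⟨X, hX, fun e => ?_⟩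
  have h := zeroSet_eq_of_ncard (hM.ncard_zeroSet X hX) hab hac hbc ha hb hc
  have h' := Set.ext_iff.1 h e
  simpa [SignVector.zeroSet] using h'

/-- The Grassmann–Plücker relation in a pencil of hyperplanes: three hyperplanes through `a`, `b`
and one of `p`, `q`, `r` each. -/
theorem pencil_three_term (hM : M.IsUniformFour) {X Y Z : SignVector E} (hX : X ∈ M.cocircuits)
    (hY : Y ∈ M.cocircuits) (hZ : Z ∈ M.cocircuits) {a b p q r : E} (hab : a ≠ b) (hap : a ≠ p)
    (haq : a ≠ q) (har : a ≠ r) (hbp : b ≠ p) (hbq : b ≠ q) (hbr : b ≠ r) (hpq : p ≠ q)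
    (hpr : p ≠ r) (hqr : q ≠ r) (hXa : X a = 0) (hXb : X b = 0) (hXp : X p = 0) (hYa : Y a = 0)
    (hYb : Y b = 0) (hYq : Y q = 0) (hZa : Z a = 0) (hZb : Z b = 0) (hZr : Z r = 0) :
    X q * X r * (Y p * Y r) * (Z p * Z q) = -1 := by
  have hXq := hM.ne_zero hX hab hap hbp hXa hXb hXp haq.symm hbq.symm hpq.symm
  have hXr := hM.ne_zero hX hab hap hbp hXa hXb hXp har.symm hbr.symm hpr.symm
  have hYp := hM.ne_zero hY hab haq hbq hYa hYb hYq hap.symm hbp.symm hpq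
  have hYr := hM.ne_zero hY hab haq hbq hYa hYb hYq har.symm hbr.symm hqr.symm
  -- It suffices to treat the case where `r` can be eliminated between `X` and `Y`.
  wlog h : X r = -Y r generalizing Y
  · have h' : X r = -(-Y) r := by
      simp only [Pi.neg_apply, neg_neg]
      revert h hXr hYr
      generalize X r = x; generalize Y r = y
      revert x y; decide
    have := this (M.neg_mem Y hY) (by simp [hYa]) (by simp [hYb]) (by simp [hYq])
      (by simpa using hYp) (by simpa using hYr) h'
    simpa using this
  obtain ⟨V, hV, hVr, hVm⟩ := exists_elimination hX hY (by
    rintro rfl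
    exact hXq (by simp [hYq])) h hXr
  have hVa : V a = 0 := by simpa [hXa, hYa] using hVm a
  have hVb : V b = 0 := by simpa [hXb, hYb] using hVm b
  have hVp := hM.ne_zero hV hab har hbr hVa hVb hVr hap.symm hbp.symm hpr
  have hVq := hM.ne_zero hV hab har hbr hVa hVb hVr haq.symm hbq.symm hqr
  have h1 : V p = Y p := by simpa [hXp, hVp] using hVm p
  have h2 : V q = X q := by simpa [hYq, hVq] using hVm q
  have key : Z p * Z q = Y p * X q := by
    rcases hM.eq_or_eq_neg hZ hV hab har hbr hZa hZb hZr hVa hVb hVr with rfl | rfl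
    · rw [h1, h2]
    · simp [h1, h2]
  rw [key, h]
  revert hXq hYp hYr
  generalize X q = x; generalize Y p = y; generalize Y r = z
  revert x y z; decide

end IsUniformFour

/-- Orthogonality of sign vectors: the entrywise products are all zero, or take both signs. -/
def Orthogonal (X C : SignVector E) : Prop :=
  (∀ m, X m * C m = 0) ∨ ((∃ m, X m * C m = 1) ∧ ∃ m, X m * C m = -1)

theorem Orthogonal.comp {X Y C : SignVector E} (hX : Orthogonal X C) (hY : Orthogonal Y C) :
    Orthogonal (SignVector.comp X Y) C := by
  have hXm : ∀ m, X m ≠ 0 → SignVector.comp X Y m = X m := fun m h => by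
    simp [SignVector.comp, h]
  rcases hX with h | ⟨⟨m, hm⟩, m', hm'⟩
  · have h' : ∀ m, SignVector.comp X Y m * C m = Y m * C m := by
      intro m
      by_cases h0 : X m = 0
      · simp [SignVector.comp, h0]
      · have : C m = 0 := (mul_eq_zero.1 (h m)).resolve_left h0
        simp [this]
    simpa [Orthogonal, h'] using hY
  · refine Or.inr ⟨⟨m, ?_⟩, m', ?_⟩
    · rw [hXm m (by intro h; simp [h] at hm), hm]
    · rw [hXm m' (by intro h; simp [h] at hm'), hm']

/-- If only `p` and `q` contribute to the products, they contribute opposite signs. -/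
theorem Orthogonal.eq_neg {X C : SignVector E} (h : Orthogonal X C) {p q : E}
    (hpq : ∀ m, m ≠ p → m ≠ q → X m = 0 ∨ C m = 0) : X p * C p = -(X q * C q) := by
  have h0 : ∀ m, m ≠ p → m ≠ q → X m * C m = 0 := fun m h1 h2 => mul_eq_zero.2 (hpq m h1 h2)
  rcases h with h | ⟨⟨m, hm⟩, m', hm'⟩
  · simp [h]
  · have h1 : m = p ∨ m = q := by
      by_contra hc
      rw [not_or] at hc
      rw [h0 m hc.1 hc.2] at hm
      exact absurd hm (by decide)
    have h2 : m' = p ∨ m' = q := by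
      by_contra hc
      rw [not_or] at hc
      rw [h0 m' hc.1 hc.2] at hm'
      exact absurd hm' (by decide)
    rcases h1 with rfl | rfl <;> rcases h2 with rfl | rfl
    · rw [hm] at hm'; exact absurd hm' (by decide)
    · rw [hm, hm']; rfl
    · rw [hm, hm']
    · rw [hm] at hm'; exact absurd hm' (by decide)

/-- Every five-element set supports a circuit. -/
theorem IsUniformFour.exists_circuit (hM : M.IsUniformFour) [DecidableEq E] {S : Finset E}
    (hS : S.card = 5) : ∃ C : SignVector E, (∀ e, C e ≠ 0 ↔ e ∈ S) ∧
      ∀ X ∈ M.covectors, Orthogonal X C := by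
  obtain ⟨o, ho⟩ : S.Nonempty := Finset.card_pos.1 (by omega)
  have card_erase : ∀ d ∈ S, ∀ e ∈ S, d ≠ e → ((S.erase d).erase e).card = 3 := by
    intro d hd e he hde
    rw [Finset.card_erase_of_mem (Finset.mem_erase.2 ⟨hde.symm, he⟩),
      Finset.card_erase_of_mem hd, hS]
  have hD : ∀ x, ∃ D : SignVector E, x ∈ S → o ≠ x →
      D ∈ M.cocircuits ∧ ∀ e, D e = 0 ↔ e ∈ (S.erase o).erase x := by
    intro x
    by_cases h : x ∈ S ∧ o ≠ x
    · obtain ⟨X, hX⟩ := hM.exists_zero_iff_mem (card_erase o ho x h.1 h.2)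
      exact ⟨X, fun _ _ => hX⟩
    · exact ⟨0, fun h1 h2 => absurd ⟨h1, h2⟩ h⟩
  choose D hD using hD
  set C : SignVector E := fun x => if x = o then 1 else if x ∈ S then -(D x o * D x x) else 0
    with hC
  have hCo : C o = 1 := by simp [hC]
  have hCx : ∀ x ∈ S, o ≠ x → C x = -(D x o * D x x) := by
    intro x hx hox
    simp [hC, hox.symm, hx]
  have hCn : ∀ x, x ∉ S → C x = 0 := by
    intro x hx
    have : x ≠ o := by
      rintro rfl
      exact hx ho
    simp [hC, this, hx]
  have supp : ∀ e, C e ≠ 0 ↔ e ∈ S := by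
    intro e
    refine ⟨fun h => by_contra fun h' => h (hCn e h'), fun he => ?_⟩
    by_cases heo : o = e
    · rw [← heo, hCo]
      decide
    · rw [hCx e he heo]
      obtain ⟨-, h⟩ := hD e he heo
      have h1 : D e o ≠ 0 := fun h' => by simpa using (h o).1 h'
      have h2 : D e e ≠ 0 := fun h' => by simpa using (h e).1 h'
      simp [h1, h2]
  -- Orthogonality to the cocircuits whose zero set is contained in `S`.
  have base : ∀ d ∈ S, ∀ X ∈ M.cocircuits, o ≠ d → (∀ m, X m = 0 ↔ m ∈ (S.erase o).erase d) →
      X o * C o = -(X d * C d) := by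
    intro d hd X hX hod h
    obtain ⟨hDm, hDz⟩ := hD d hd hod
    have h1 : X o ≠ 0 := fun h' => by simpa using (h o).1 h'
    have h2 : X d ≠ 0 := fun h' => by simpa using (h d).1 h'
    rw [hCo, hCx d hd hod]
    rcases M.eq_or_eq_neg X hX (D d) hDm (fun m hm => (hDz m).2 ((h m).1 hm)) with h' | h'
    · rw [← h']
      revert h1 h2
      generalize X o = x; generalize X d = y
      revert x y; decide
    · have h'' : D d = -X := by rw [h', neg_neg]
      rw [h'']
      simp only [Pi.neg_apply]
      revert h1 h2
      generalize X o = x; generalize X d = y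
      revert x y; decide
  have pair : ∀ d ∈ S, ∀ e ∈ S, d ≠ e → ∀ X ∈ M.cocircuits,
      (∀ m, X m = 0 ↔ m ∈ (S.erase d).erase e) → X d * C d = -(X e * C e) := by
    intro d hd e he hde X hX h
    by_cases hod : o = d
    · subst hod
      exact base e he X hX hde h
    by_cases hoe : o = e
    · subst hoe
      rw [base d hd X hX hod (fun m => by rw [h, Finset.erase_right_comm]), neg_neg]
    obtain ⟨p, q, hpq, hPQ⟩ : ∃ p q, p ≠ q ∧ ((S.erase d).erase e).erase o = {p, q} := by
      apply Finset.card_eq_two.1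
      rw [Finset.card_erase_of_mem (by simp [hod, hoe, ho]), card_erase d hd e he hde]
    have hp : p ∈ ((S.erase d).erase e).erase o := by rw [hPQ]; simp
    have hq : q ∈ ((S.erase d).erase e).erase o := by rw [hPQ]; simp
    simp only [Finset.mem_erase, ne_eq] at hp hq
    obtain ⟨hd1, hd2⟩ := hD d hd hod
    obtain ⟨he1, he2⟩ := hD e he hoe
    have h3 := hM.pencil_three_term hX he1 hd1 (a := p) (b := q) (p := o) (q := d) (r := e) hpq
      hp.1 hp.2.2.1 hp.2.1 hq.1 hq.2.2.1 hq.2.1 hod hoe hde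
      ((h p).2 (by simp [hp])) ((h q).2 (by simp [hq])) ((h o).2 (by simp [hod, hoe, ho]))
      ((he2 p).2 (by simp [hp])) ((he2 q).2 (by simp [hq]))
      ((he2 d).2 (by simp [Ne.symm hod, hde, hd]))
      ((hd2 p).2 (by simp [hp])) ((hd2 q).2 (by simp [hq]))
      ((hd2 e).2 (by simp [Ne.symm hoe, Ne.symm hde, he]))
    rw [hCx d hd hod, hCx e he hoe]
    revert h3
    generalize X d = x; generalize X e = y; generalize D e o * D e e = z
    generalize D d o * D d d = w
    revert x y z w
    decide
  -- Elimination within `S` reduces an arbitrary cocircuit to one with three zeros in `S`.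
  have cocirc : ∀ k, ∀ X ∈ M.cocircuits, (S.filter (fun m => X m ≠ 0)).card ≤ k →
      ∃ m, X m * C m = -1 := by
    intro k
    induction k with
    | zero =>
      intro X hX hk
      exfalso
      have h3 : X.zeroSet.ncard = 3 := hM.ncard_zeroSet X hX
      have hsub : (S : Set E) ⊆ X.zeroSet := by
        intro m hm
        by_contra hXm
        have : m ∈ S.filter (fun m => X m ≠ 0) := Finset.mem_filter.2 ⟨hm, hXm⟩
        rw [Finset.card_eq_zero.1 (Nat.le_zero.1 hk)] at this
        simp at this
      have := Set.ncard_le_ncard hsub (Set.finite_of_ncard_ne_zero (by omega))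
      rw [Set.ncard_coe_finset] at this
      omega
    | succ k ih =>
      intro X hX hk
      by_contra hneg
      have hneg' : ∀ m, X m * C m ≠ -1 := fun m hm => hneg ⟨m, hm⟩
      have h3 : X.zeroSet.ncard = 3 := hM.ncard_zeroSet X hX
      have hfin : X.zeroSet.Finite := Set.finite_of_ncard_ne_zero (by omega)
      have hN : (S.filter (fun m => X m = 0)).card ≤ 3 := by
        rw [← h3, ← Set.ncard_coe_finset]
        exact Set.ncard_le_ncard (fun m hm => (Finset.mem_filter.1 (Finset.mem_coe.1 hm)).2) hfin
      have hsum := Finset.card_filter_add_card_filter_not (s := S) (fun m => X m = 0)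
      obtain ⟨d, hd, e, he, hde⟩ : ∃ d ∈ S.filter (fun m => ¬ X m = 0),
          ∃ e ∈ S.filter (fun m => ¬ X m = 0), d ≠ e :=
        Finset.one_lt_card.1 (by omega)
      rw [Finset.mem_filter] at hd he
      obtain ⟨K, hK, hKz⟩ := hM.exists_zero_iff_mem (card_erase d hd.1 e he.1 hde)
      have hp := pair d hd.1 e he.1 hde K hK hKz
      have hKd : K d ≠ 0 := fun h' => by simpa using (hKz d).1 h'
      have hKe : K e ≠ 0 := fun h' => by simpa using (hKz e).1 h'
      have hCd := (supp d).2 hd.1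
      have hCe := (supp e).2 he.1
      wlog hs : K e = -X e generalizing K
      · refine this (-K) (M.neg_mem K hK) (fun m => by simp [hKz]) (by simp [hp])
          (by simpa using hKd) (by simpa using hKe) ?_
        have := he.2
        simp only [Pi.neg_apply]
        revert hs this hKe
        generalize K e = x; generalize X e = y
        revert x y; decide
      by_cases hXK : X = -K
      · apply hneg
        rcases (show K d * C d = 1 ∨ K d * C d = -1 by
          revert hKd hCd
          generalize K d = x; generalize C d = y
          revert x y; decide) with h | h
        · exact ⟨d, by rw [hXK]; simp [h]⟩
        · exact ⟨e, by rw [hXK]; simpa [h] using hp.symm⟩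
      obtain ⟨Z, hZ, hZe, hZm⟩ := exists_elimination hX hK hXK (e := e) (by rw [hs, neg_neg]) he.2
      have hlt : (S.filter (fun m => Z m ≠ 0)).card < (S.filter (fun m => X m ≠ 0)).card := by
        apply Finset.card_lt_card
        rw [Finset.ssubset_iff_of_subset]
        · exact ⟨e, by simp [he], by simp [hZe]⟩
        · intro m hm
          rw [Finset.mem_filter] at hm ⊢
          refine ⟨hm.1, fun hXm => ?_⟩
          have hKm : K m = 0 := by
            rw [hKz]
            simp only [Finset.mem_erase, ne_eq]
            refine ⟨?_, ?_, hm.1⟩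
            · rintro rfl
              exact he.2 hXm
            · rintro rfl
              exact hd.2 hXm
          rcases hZm m with h | h | h
          · exact hm.2 h
          · exact hm.2 (h.trans hXm)
          · exact hm.2 (h.trans hKm)
      obtain ⟨m, hm⟩ := ih Z hZ (by omega)
      rcases hZm m with h | h | h
      · rw [h] at hm
        simp at hm
      · exact hneg' m (by rw [← h, hm])
      · -- Here `m = d`, where `X` and `K` agree.
        rw [h] at hm
        have hKm : K m ≠ 0 := by
          intro h'
          rw [h'] at hm
          simp at hm
        have hCm : C m ≠ 0 := by
          intro h'
          rw [h'] at hm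
          simp at hm
        have hmS := (supp m).1 hCm
        have hmde : m = d ∨ m = e := by
          by_contra hc
          rw [not_or] at hc
          exact hKm ((hKz m).2 (by simp [hc.1, hc.2, hmS]))
        rcases hmde with rfl | rfl
        · have h1 := hneg' e
          have h2 := he.2
          rw [hm, hs] at hp
          revert hp h1 h2
          generalize X e = x
          generalize C e = y
          revert x y
          decide
        · exact hKm (h ▸ hZe)
  refine ⟨C, supp, ?_⟩
  rintro X ⟨l, hl, rfl⟩
  induction l with
  | nil => exact Or.inl (fun m => by simp)
  | cons Y l ih =>
    refine Orthogonal.comp ?_ (ih fun Z hZ => hl Z (List.mem_cons_of_mem _ hZ))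
    have hY := hl Y List.mem_cons_self
    obtain ⟨m, hm⟩ := cocirc _ Y hY le_rfl
    obtain ⟨m', hm'⟩ := cocirc _ (-Y) (M.neg_mem Y hY) le_rfl
    refine Or.inr ⟨⟨m', ?_⟩, m, hm⟩
    rw [Pi.neg_apply, neg_mul] at hm'
    rw [← neg_neg (Y m' * C m'), hm']
    rfl

/-! ### Circuits and facets of matroid polytopes -/

/-- In a matroid polytope no circuit has the same sign at all of its elements but possibly one:
it could not be orthogonal to the covector of the extreme point `v`. -/
theorem IsMatroidPolytope.not_separates (hP : M.IsMatroidPolytope) {C : SignVector E}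
    (hC : ∀ X ∈ M.covectors, Orthogonal X C) {u v : E} (huv : u ≠ v) (hu : C u ≠ 0)
    (h : ∀ m, m ≠ v → C m ≠ 0 → C m = C u) : False := by
  obtain ⟨X, hX, hXv⟩ := (hP v).1
  have hv : X v = 0 := (hXv v).1 rfl
  have h1 : ∀ m, m ≠ v → X m = 1 := fun m hm => (hXv m).2 hm
  have hs : ∀ m s, X m * C m = s → s ≠ 0 → C m = s ∧ C m = C u := by
    intro m s hm hs
    have hmv : m ≠ v := by
      rintro rfl
      rw [hv, zero_mul] at hm
      exact hs hm.symm
    rw [h1 m hmv, one_mul] at hm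
    exact ⟨hm, h m hmv (hm ▸ hs)⟩
  rcases hC X hX with h0 | ⟨⟨m, hm⟩, m', hm'⟩
  · have := h0 u
    rw [h1 u huv, one_mul] at this
    exact hu this
  · obtain ⟨h2, h3⟩ := hs m 1 hm (by decide)
    obtain ⟨h4, h5⟩ := hs m' (-1) hm' (by decide)
    rw [← h3, h2] at h5
    rw [h5] at h4
    exact absurd h4 (by decide)

/-- Some cocircuit is positive off its zero set: the first one in a composition of cocircuits that
yields the covector of an extreme point. -/
theorem IsMatroidPolytope.exists_facet (hM : M.IsUniformFour) (hP : M.IsMatroidPolytope)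
    (e e' : E) (hne : e ≠ e') :
    ∃ V ∈ M.cocircuits, ∃ a b c, a ≠ b ∧ a ≠ c ∧ b ≠ c ∧ V a = 0 ∧ V b = 0 ∧ V c = 0 ∧
      ∀ m, m ≠ a → m ≠ b → m ≠ c → V m = 1 := by
  obtain ⟨X, hX, hXe⟩ := (hP e).1
  obtain ⟨V, hV, hc⟩ := exists_cocircuit_conforms hX (by
    rintro rfl
    simpa using (hXe e').2 hne.symm)
  obtain ⟨a, b, c, hab, hac, hbc, hz⟩ := Set.ncard_eq_three.1 (hM.ncard_zeroSet V hV)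
  have hz' : ∀ m, V m = 0 ↔ m = a ∨ m = b ∨ m = c := fun m => by
    have := Set.ext_iff.1 hz m
    simpa [SignVector.zeroSet] using this
  refine ⟨V, hV, a, b, c, hab, hac, hbc, by simp [hz'], by simp [hz'], by simp [hz'], ?_⟩
  intro m ha hb hc'
  have hVm : V m ≠ 0 := by simp [hz', ha, hb, hc']
  have h1 : X m = V m := (hc m).resolve_right hVm
  have hme : m ≠ e := by
    rintro rfl
    rw [(hXe m).1 rfl] at h1
    exact hVm h1.symm
  rw [← h1, (hXe m).2 hme]

/-- With at least five elements, some two elements of any facet are separated by a hyperplane. -/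
theorem IsUniformFour.exists_separating (hM : M.IsUniformFour) {a b c x y : E} (hab : a ≠ b)
    (hac : a ≠ c) (hbc : b ≠ c) (hax : a ≠ x) (hay : a ≠ y) (hbx : b ≠ x) (hby : b ≠ y)
    (hcx : c ≠ x) (hcy : c ≠ y) (hxy : x ≠ y) :
    ∃ f g h, f ≠ g ∧ f ≠ h ∧ g ≠ h ∧ (∀ m, m = f ∨ m = g ∨ m = h ↔ m = a ∨ m = b ∨ m = c) ∧
      ∃ X ∈ M.cocircuits, X f = 1 ∧ X g = -1 := by
  classical
  obtain ⟨C, hsupp, hC⟩ := hM.exists_circuit (S := {a, b, c, x, y}) (by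
    rw [Finset.card_insert_of_notMem, Finset.card_insert_of_notMem,
      Finset.card_insert_of_notMem, Finset.card_insert_of_notMem, Finset.card_singleton] <;>
      simp [hab, hac, hbc, hax, hay, hbx, hby, hcx, hcy, hxy])
  simp only [Finset.mem_insert, Finset.mem_singleton] at hsupp
  have sep : ∀ f g h, f ≠ g → f ≠ h → f ≠ x → f ≠ y → h ≠ x → h ≠ y →
      (∀ m, m = f ∨ m = g ∨ m = h ↔ m = a ∨ m = b ∨ m = c) → C f = C g →
      ∃ X ∈ M.cocircuits, X f = 1 ∧ X g = -1 := by
    intro f g h hfg hfh hfx hfy hhx hhy hfgh hCfg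
    obtain ⟨X, hX, hXh, hXx, hXy, hXf⟩ := hM.exists_normalized hhx hhy hxy hfh hfx hfy
    refine ⟨X, hX, hXf, ?_⟩
    have := (hC X (cocircuits_subset_covectors hX)).eq_neg (p := f) (q := g) (by
      intro m hmf hmg
      by_cases hm : C m = 0
      · exact Or.inr hm
      · have h1 := (hsupp m).1 hm
        have h2 := hfgh m
        have h3 : m = h ∨ m = x ∨ m = y := by tauto
        rcases h3 with rfl | rfl | rfl <;> simp_all)
    have hCf : C f ≠ 0 := (hsupp f).2 (by have := hfgh f; tauto)
    rw [hXf, ← hCfg] at this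
    revert this hCf
    generalize X g = p; generalize C f = q
    revert p q; decide
  have hCa : C a ≠ 0 := (hsupp a).2 (by simp)
  have hCb : C b ≠ 0 := (hsupp b).2 (by simp)
  have hCc : C c ≠ 0 := (hsupp c).2 (by simp)
  -- Two of the three elements have the same sign in the circuit.
  have hpig : C a = C b ∨ C a = C c ∨ C b = C c := by
    revert hCa hCb hCc
    generalize C a = p; generalize C b = q; generalize C c = r
    revert p q r; decide
  rcases hpig with h | h | h
  · exact ⟨a, b, c, hab, hac, hbc, fun m => Iff.rfl,
      sep a b c hab hac hax hay hcx hcy (fun m => Iff.rfl) h⟩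
  · exact ⟨a, c, b, hac, hab, hbc.symm, fun m => by tauto,
      sep a c b hac hab hax hay hbx hby (fun m => by tauto) h⟩
  · exact ⟨b, c, a, hbc, hab.symm, hac.symm, fun m => by tauto,
      sep b c a hbc hab.symm hbx hby hax hay (fun m => by tauto) h⟩

/-! ### The linear order about two elements of a facet -/

/-- `pos` is the order in which a hyperplane rotating about `f` and `g` sweeps over the other
elements: all elements on the same side of `u` in this order are on the same side of the
hyperplane through `f`, `g` and `u`. -/
structure IsSweepOrder (M : OrientedMatroid E) (f g : E) (pos : E → ℕ) : Prop where
  inj : ∀ p q, p ≠ f → p ≠ g → q ≠ f → q ≠ g → pos p = pos q → p = q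
  same_side : ∀ Y ∈ M.cocircuits, ∀ u v w, u ≠ f → u ≠ g → v ≠ f → v ≠ g → w ≠ f → w ≠ g →
    Y f = 0 → Y g = 0 → Y u = 0 →
    (pos u < pos v ∧ pos u < pos w ∨ pos v < pos u ∧ pos w < pos u) → Y v = Y w

/-- If `f` and `g` lie on a common facet, the remaining elements are linearly ordered about
them, beginning with the third element of that facet. -/
theorem IsUniformFour.exists_isSweepOrder [Finite E] (hM : M.IsUniformFour) {V : SignVector E}
    (hV : V ∈ M.cocircuits) {f g h : E} (hfg : f ≠ g) (hfh : f ≠ h) (hgh : g ≠ h) (hVf : V f = 0)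
    (hVg : V g = 0) (hVh : V h = 0) (hpos : ∀ m, m ≠ f → m ≠ g → m ≠ h → V m = 1) :
    ∃ pos : E → ℕ, IsSweepOrder M f g pos := by
  have hY : ∀ u, ∃ Y : SignVector E, u ≠ f → u ≠ g → Y ∈ M.cocircuits ∧ Y f = 0 ∧ Y g = 0 ∧
      Y u = 0 ∧ (u = h → Y = V) ∧ (u ≠ h → Y h = -1) := by
    intro u
    by_cases hu : u ≠ f ∧ u ≠ g
    · by_cases huh : u = h
      · exact ⟨V, fun _ _ => ⟨hV, hVf, hVg, huh ▸ hVh, fun _ => rfl, fun h' => absurd huh h'⟩⟩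
      · obtain ⟨X, hX, h1, h2, h3, h4⟩ := hM.exists_normalized hfg hu.1.symm hu.2.symm
          hfh.symm hgh.symm (Ne.symm huh)
        exact ⟨-X, fun _ _ => ⟨M.neg_mem X hX, by simp [h1], by simp [h2], by simp [h3],
          fun h' => absurd h' huh, fun _ => by simp [h4]⟩⟩
    · exact ⟨0, fun h1 h2 => absurd ⟨h1, h2⟩ hu⟩
  choose Y hY using hY
  have anti : ∀ p q, p ≠ f → p ≠ g → q ≠ f → q ≠ g → p ≠ q → Y p q = -Y q p := by
    intro p q hpf hpg hqf hqg hpq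
    obtain ⟨p1, p2, p3, p4, p5, p6⟩ := hY p hpf hpg
    obtain ⟨q1, q2, q3, q4, q5, q6⟩ := hY q hqf hqg
    by_cases hph : p = h
    · have hqh : q ≠ h := hph ▸ hpq.symm
      rw [p5 hph, hpos q hqf hqg hqh, hph, q6 hqh]
      rfl
    by_cases hqh : q = h
    · rw [q5 hqh, hpos p hpf hpg hph, hqh, p6 hph]
    have := hM.pencil_three_term p1 q1 hV hfg hpf.symm hqf.symm hfh hpg.symm hqg.symm hgh hpq hph
      hqh p2 p3 p4 q2 q3 q4 hVf hVg hVh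
    rw [p6 hph, q6 hqh, hpos p hpf hpg hph, hpos q hqf hqg hqh] at this
    revert this
    generalize Y p q = x; generalize Y q p = y
    revert x y; decide
  have nz : ∀ p q, p ≠ f → p ≠ g → q ≠ f → q ≠ g → p ≠ q → Y p q ≠ 0 := by
    intro p q hpf hpg hqf hqg hpq
    obtain ⟨p1, p2, p3, p4, -, -⟩ := hY p hpf hpg
    exact hM.ne_zero p1 hfg hpf.symm hpg.symm p2 p3 p4 hqf hqg hpq.symm
  have self : ∀ p, p ≠ f → p ≠ g → Y p p = 0 := fun p hpf hpg => (hY p hpf hpg).2.2.2.1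
  set lt : E → E → Prop := fun p q => p ≠ f ∧ p ≠ g ∧ q ≠ f ∧ q ≠ g ∧ Y p q = 1 with hlt
  have lt_ne : ∀ p q, lt p q → p ≠ q := by
    rintro p q ⟨hpf, hpg, -, -, h1⟩ rfl
    rw [self p hpf hpg] at h1
    exact absurd h1 (by decide)
  have asymm : ∀ p q, lt p q → ¬ lt q p := by
    intro p q h1 h2
    have := anti p q h1.1 h1.2.1 h2.1 h2.2.1 (lt_ne p q h1)
    rw [h1.2.2.2.2, h2.2.2.2.2] at this
    exact absurd this (by decide)
  have total : ∀ p q, p ≠ f → p ≠ g → q ≠ f → q ≠ g → p ≠ q → lt p q ∨ lt q p := by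
    intro p q hpf hpg hqf hqg hpq
    have h1 := anti p q hpf hpg hqf hqg hpq
    have h2 := nz p q hpf hpg hqf hqg hpq
    have h3 : Y p q = 1 ∨ Y q p = 1 := by
      revert h1 h2
      generalize Y p q = x; generalize Y q p = y
      revert x y; decide
    exact h3.imp (fun h => ⟨hpf, hpg, hqf, hqg, h⟩) (fun h => ⟨hqf, hqg, hpf, hpg, h⟩)
  have trans : ∀ p q r, lt p q → lt q r → lt p r := by
    intro p q r hpq hqr
    have hpr : p ≠ r := by
      rintro rfl
      exact asymm _ _ hpq hqr
    obtain ⟨hpf, hpg, hqf, hqg, hpq1⟩ := hpq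
    obtain ⟨-, -, hrf, hrg, hqr1⟩ := hqr
    by_contra hc
    have hrp : Y p r = -1 := by
      have h1 := nz p r hpf hpg hrf hrg hpr
      have h2 : Y p r ≠ 1 := fun h => hc ⟨hpf, hpg, hrf, hrg, h⟩
      revert h1 h2
      generalize Y p r = x
      revert x; decide
    obtain ⟨p1, p2, p3, p4, p5, p6⟩ := hY p hpf hpg
    obtain ⟨q1, q2, q3, q4, q5, q6⟩ := hY q hqf hqg
    obtain ⟨r1, r2, r3, r4, r5, r6⟩ := hY r hrf hrg
    have hqr : q ≠ r := by
      rintro rfl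
      rw [q4] at hqr1
      exact absurd hqr1 (by decide)
    have hph : p ≠ h := by
      intro hph
      rw [p5 hph, hpos r hrf hrg (hph ▸ hpr.symm)] at hrp
      exact absurd hrp (by decide)
    have hqh : q ≠ h := by
      rintro rfl
      rw [p6 hph] at hpq1
      exact absurd hpq1 (by decide)
    have hrh : r ≠ h := by
      rintro rfl
      rw [q6 hqh] at hqr1
      exact absurd hqr1 (by decide)
    -- A cyclic triple `p`, `q`, `r` is refuted by eliminating `r`.
    obtain ⟨Z, hZ, hZr, hZm⟩ := exists_elimination p1 q1 (e := r) (by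
      intro h'
      rw [h'] at hpq1
      simp [q4] at hpq1) (by rw [hrp, hqr1]) (by rw [hrp]; decide)
    have hZf : Z f = 0 := by simpa [p2, q2] using hZm f
    have hZg : Z g = 0 := by simpa [p3, q3] using hZm g
    have hZh : Z h = -1 := by
      have := hM.ne_zero hZ hfg hrf.symm hrg.symm hZf hZg hZr hfh.symm hgh.symm hrh.symm
      simpa [p6 hph, q6 hqh, this] using hZm h
    have hZq : Z q = 1 := by
      have := hM.ne_zero hZ hfg hrf.symm hrg.symm hZf hZg hZr hqf hqg hqr
      simpa [q4, hpq1, this] using hZm q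
    have hrq : Y r q = -1 := by rw [anti r q hrf hrg hqf hqg hqr.symm, hqr1]
    rcases hM.eq_or_eq_neg hZ r1 hfg hrf.symm hrg.symm hZf hZg hZr r2 r3 r4 with h' | h'
    · rw [h', hrq] at hZq
      exact absurd hZq (by decide)
    · rw [h', Pi.neg_apply, r6 hrh] at hZh
      exact absurd hZh (by decide)
  set pos : E → ℕ := fun p => {q | lt q p}.ncard with hposdef
  have mono : ∀ p q, lt p q → pos p < pos q := by
    intro p q hpq
    apply Set.ncard_lt_ncard _ (Set.toFinite _)
    refine ⟨fun r hr => trans r p q hr hpq, fun hsub => ?_⟩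
    exact lt_ne p p (hsub hpq) rfl
  have of_pos : ∀ p q, p ≠ f → p ≠ g → q ≠ f → q ≠ g → pos p < pos q → lt p q := by
    intro p q hpf hpg hqf hqg h'
    have hpq : p ≠ q := by
      rintro rfl
      exact lt_irrefl _ h'
    rcases total p q hpf hpg hqf hqg hpq with h1 | h1
    · exact h1
    · exact absurd (mono q p h1) (by omega)
  refine ⟨pos, ?_, ?_⟩
  · intro p q hpf hpg hqf hqg h'
    by_contra hpq
    rcases total p q hpf hpg hqf hqg hpq with h1 | h1
    · exact absurd (mono p q h1) (by omega)
    · exact absurd (mono q p h1) (by omega)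
  · intro X hX u v w huf hug hvf hvg hwf hwg hXf hXg hXu hs
    obtain ⟨u1, u2, u3, u4, -, -⟩ := hY u huf hug
    have key : Y u v = Y u w := by
      rcases hs with ⟨h1, h2⟩ | ⟨h1, h2⟩
      · rw [(of_pos u v huf hug hvf hvg h1).2.2.2.2, (of_pos u w huf hug hwf hwg h2).2.2.2.2]
      · have h1' := of_pos v u hvf hvg huf hug h1
        have h2' := of_pos w u hwf hwg huf hug h2
        rw [anti u v huf hug hvf hvg (lt_ne v u h1').symm,
          anti u w huf hug hwf hwg (lt_ne w u h2').symm, h1'.2.2.2.2, h2'.2.2.2.2]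
    rcases hM.eq_or_eq_neg hX u1 hfg huf.symm hug.symm hXf hXg hXu u2 u3 u4 with h' | h'
    · rw [h', key]
    · simp only [h', Pi.neg_apply, key]

/-- The circuit through `f`, `g` and three elements `u < v < w` of the sweep order: `f` and `g`
being on the same side, they are on the side of `v`, and `u`, `w` are on the other one. -/
theorem IsSweepOrder.circuit_signs (hP : M.IsMatroidPolytope) (hM : M.IsUniformFour) {f g : E}
    {pos : E → ℕ} (ho : IsSweepOrder M f g pos) (hfg : f ≠ g) {C : SignVector E}
    (hC : ∀ X ∈ M.covectors, Orthogonal X C) {u v w : E}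
    (hsupp : ∀ e, C e ≠ 0 ↔ e = u ∨ e = v ∨ e = w ∨ e = f ∨ e = g)
    (huf : u ≠ f) (hug : u ≠ g) (hvf : v ≠ f) (hvg : v ≠ g) (hwf : w ≠ f) (hwg : w ≠ g)
    (huv : pos u < pos v) (hvw : pos v < pos w) (hCfg : C f = C g) :
    C v = C g ∧ C u = -C g ∧ C w = -C g := by
  have huv' : u ≠ v := by
    rintro rfl
    exact lt_irrefl _ huv
  have hvw' : v ≠ w := by
    rintro rfl
    exact lt_irrefl _ hvw
  have huw' : u ≠ w := by
    rintro rfl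
    omega
  have hCu : C u ≠ 0 := (hsupp u).2 (by simp)
  have hCv : C v ≠ 0 := (hsupp v).2 (by simp)
  have hCw : C w ≠ 0 := (hsupp w).2 (by simp)
  have hCg : C g ≠ 0 := (hsupp g).2 (by simp)
  -- Two elements on the same side of a plane through `f`, `g` and the third have opposite signs.
  have opp : ∀ x y z, x ≠ f → x ≠ g → y ≠ f → y ≠ g → z ≠ f → z ≠ g → y ≠ x → z ≠ x →
      (∀ e, C e ≠ 0 → e = x ∨ e = y ∨ e = z ∨ e = f ∨ e = g) →
      (pos x < pos y ∧ pos x < pos z ∨ pos y < pos x ∧ pos z < pos x) → C y = -C z := by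
    intro x y z hxf hxg hyf hyg hzf hzg hyx hzx hs hxyz
    obtain ⟨Y, hY, hYf, hYg, hYx⟩ := hM.exists_vanishing f g x hfg
    have hYy := hM.ne_zero hY hfg hxf.symm hxg.symm hYf hYg hYx hyf hyg hyx
    have h1 := ho.same_side Y hY x y z hxf hxg hyf hyg hzf hzg hYf hYg hYx hxyz
    have h2 := (hC Y (cocircuits_subset_covectors hY)).eq_neg (p := y) (q := z) (by
      intro m hmy hmz
      by_cases hm : C m = 0
      · exact Or.inr hm
      · rcases hs m hm with rfl | rfl | rfl | rfl | rfl
        · exact Or.inl hYx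
        · exact absurd rfl hmy
        · exact absurd rfl hmz
        · exact Or.inl hYf
        · exact Or.inl hYg)
    rw [← h1] at h2
    revert hYy h2
    generalize Y y = a; generalize C y = b; generalize C z = c
    revert a b c; decide
  have h1 : C v = -C w := opp u v w huf hug hvf hvg hwf hwg huv'.symm huw'.symm
    (fun e he => (hsupp e).1 he) (Or.inl ⟨huv, by omega⟩)
  have h2 : C u = -C v := opp w u v hwf hwg huf hug hvf hvg huw' hvw'
    (fun e he => by have := (hsupp e).1 he; tauto) (Or.inr ⟨by omega, hvw⟩)
  have h3 : C v = C g := by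
    by_contra hne
    refine hP.not_separates hC (u := g) (v := v) hvg.symm hCg fun m hm hm0 => ?_
    have h4 : C u = C g ∧ C w = C g := by
      have h5 : C v = -C g := by
        exact SignType.eq_neg_of_ne hCv hCg hne
      refine ⟨by rw [h2, h5, neg_neg], ?_⟩
      rw [← neg_neg (C w), ← h1, h5, neg_neg]
    rcases (hsupp m).1 hm0 with rfl | rfl | rfl | rfl | rfl
    · exact h4.1
    · exact absurd rfl hm
    · exact h4.2
    · exact hCfg
    · rfl
  refine ⟨h3, by rw [h2, h3], ?_⟩
  rw [← h3, h1, neg_neg]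

/-- If the hyperplane through `a`, `b`, `i` separates `f` from `g`, then the hyperplane through
`a`, `b`, `f` separates `i` from `g` exactly when `i` is between `a` and `b` in the sweep order. -/
theorem IsSweepOrder.sign_eq (hP : M.IsMatroidPolytope) (hM : M.IsUniformFour) {f g : E}
    {pos : E → ℕ} (ho : IsSweepOrder M f g pos) (hfg : f ≠ g) {a b i : E} (hab : a ≠ b)
    (hai : a ≠ i) (hbi : b ≠ i) {Z W : SignVector E} (hZ : Z ∈ M.cocircuits)
    (hW : W ∈ M.cocircuits) (hZa : Z a = 0) (hZb : Z b = 0) (hZi : Z i = 0) (hZf : Z f = 1)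
    (hZg : Z g = -1) (hWa : W a = 0) (hWb : W b = 0) (hWf : W f = 0) (hWg : W g = 1) :
    W i = (if pos i < pos a then -1 else 1) * (if pos i < pos b then -1 else 1) := by
  classical
  have ne_of : ∀ x, Z x = 0 → x ≠ f ∧ x ≠ g := by
    intro x hx
    constructor <;> rintro rfl
    · rw [hx] at hZf; exact absurd hZf (by decide)
    · rw [hx] at hZg; exact absurd hZg (by decide)
  obtain ⟨haf, hag⟩ := ne_of a hZa
  obtain ⟨hbf, hbg⟩ := ne_of b hZb
  obtain ⟨hif, hig⟩ := ne_of i hZi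
  obtain ⟨C, hsupp, hC⟩ := hM.exists_circuit (S := {a, b, i, f, g}) (by
    rw [Finset.card_insert_of_notMem, Finset.card_insert_of_notMem,
      Finset.card_insert_of_notMem, Finset.card_insert_of_notMem, Finset.card_singleton] <;>
      simp [hab, hai, hbi, haf, hag, hbf, hbg, hif, hig, hfg])
  simp only [Finset.mem_insert, Finset.mem_singleton] at hsupp
  have hCfg : C f = C g := by
    have := (hC Z (cocircuits_subset_covectors hZ)).eq_neg (p := f) (q := g) (by
      intro m hmf hmg
      by_cases hm : C m = 0
      · exact Or.inr hm
      · rcases (hsupp m).1 hm with rfl | rfl | rfl | rfl | rfl <;> tauto)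
    rw [hZf, hZg] at this
    simpa using this
  have hWi : W i * C i = -C g := by
    have := (hC W (cocircuits_subset_covectors hW)).eq_neg (p := i) (q := g) (by
      intro m hmf hmg
      by_cases hm : C m = 0
      · exact Or.inr hm
      · rcases (hsupp m).1 hm with rfl | rfl | rfl | rfl | rfl <;> tauto)
    rw [hWg] at this
    simpa using this
  have hCg : C g ≠ 0 := (hsupp g).2 (by simp)
  have inner : C i = C g → W i = -1 := by
    intro h
    rw [h] at hWi
    revert hWi hCg
    generalize W i = x; generalize C g = y
    revert x y; decide
  have outer : C i = -C g → W i = 1 := by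
    intro h
    rw [h] at hWi
    revert hWi hCg
    generalize W i = x; generalize C g = y
    revert x y; decide
  have pab : pos a ≠ pos b := fun h => hab (ho.inj a b haf hag hbf hbg h)
  have pai : pos a ≠ pos i := fun h => hai (ho.inj a i haf hag hif hig h)
  have pbi : pos b ≠ pos i := fun h => hbi (ho.inj b i hbf hbg hif hig h)
  have sgn := fun (u v w : E) hs h1 h2 h3 h4 h5 h6 h7 h8 =>
    ho.circuit_signs hP hM hfg hC (u := u) (v := v) (w := w) hs h1 h2 h3 h4 h5 h6 h7 h8 hCfg
  rcases lt_or_gt_of_ne pai with h1 | h1 <;> rcases lt_or_gt_of_ne pbi with h2 | h2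
  · rw [if_neg (by omega), if_neg (by omega)]
    apply outer
    rcases lt_or_gt_of_ne pab with h3 | h3
    · exact (sgn a b i hsupp haf hag hbf hbg hif hig h3 h2).2.2
    · exact (sgn b a i (fun e => by rw [hsupp]; clear * -; tauto) hbf hbg haf hag hif hig h3 h1).2.2
  · rw [if_neg (by omega), if_pos (by omega)]
    apply inner
    exact (sgn a i b (fun e => by rw [hsupp]; clear * -; tauto) haf hag hif hig hbf hbg h1 h2).1
  · rw [if_pos (by omega), if_neg (by omega)]
    apply inner
    exact (sgn b i a (fun e => by rw [hsupp]; clear * -; tauto) hbf hbg hif hig haf hag h2 h1).1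
  · rw [if_pos (by omega), if_pos (by omega)]
    apply outer
    rcases lt_or_gt_of_ne pab with h3 | h3
    · exact (sgn i a b (fun e => by rw [hsupp]; clear * -; tauto) hif hig haf hag hbf hbg h1 h3).2.1
    · exact (sgn i b a (fun e => by rw [hsupp]; clear * -; tauto) hif hig hbf hbg haf hag h2 h3).2.1

/-! ### Simplices -/

open Classical in
/-- The sign vector of a face of the simplex region of `T` bounded by the elements `b j`, namely of
the face spanned by the vertices in `s`: it vanishes at `b j` for `j ∉ s` and agrees with `T`
elsewhere. The empty face is the zero vector. -/
noncomputable def faceVector (b : Fin 4 → E) (T : SignVector E) (s : Finset (Fin 4)) :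
    SignVector E := fun e => if s = ∅ ∨ ∃ j, j ∉ s ∧ b j = e then 0 else T e

theorem faceVector_empty (b : Fin 4 → E) (T : SignVector E) : faceVector b T ∅ = 0 := by
  funext e
  simp [faceVector]

theorem faceVector_apply {b : Fin 4 → E} (hb : Function.Injective b) (T : SignVector E)
    (s : Finset (Fin 4)) (i : Fin 4) : faceVector b T s (b i) = if i ∈ s then T (b i) else 0 := by
  by_cases hi : i ∈ s
  · rw [if_pos hi, faceVector, if_neg]
    rintro (rfl | ⟨j, hj, hji⟩)
    · simp at hi
    · exact hj (hb hji ▸ hi)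
  · rw [if_neg hi, faceVector, if_pos (Or.inr ⟨i, hi, rfl⟩)]

theorem faceVector_of_forall_ne {b : Fin 4 → E} (T : SignVector E) {s : Finset (Fin 4)}
    (hs : s.Nonempty) {e : E} (he : ∀ j, b j ≠ e) : faceVector b T s e = T e := by
  rw [faceVector, if_neg]
  rintro (h | ⟨j, -, hj⟩)
  · exact hs.ne_empty h
  · exact he j hj

/-- The region with sign vector `T` is a simplex bounded by the elements `b j`: its four vertices
are cocircuits. -/
structure IsSimplexAt (M : OrientedMatroid E) (b : Fin 4 → E) (T : SignVector E) : Prop where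
  inj : Function.Injective b
  ne_zero : ∀ e, T e ≠ 0
  vertex : ∀ i, faceVector b T {i} ∈ M.cocircuits

/-- Four cocircuits, each vanishing at three of four given elements, that agree at all other
elements are the vertices of a simplex. -/
theorem IsUniformFour.exists_isSimplexAt (hM : M.IsUniformFour) {b : Fin 4 → E}
    (hb : Function.Injective b) {Y : Fin 4 → SignVector E} (hY : ∀ i, Y i ∈ M.cocircuits)
    (h0 : ∀ i j, i ≠ j → Y i (b j) = 0)
    (hagree : ∀ i e, (∀ j, b j ≠ e) → Y i e = Y 0 e) : ∃ T, IsSimplexAt M b T := by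
  classical
  have hne : ∀ i e, (∀ j, i ≠ j → b j ≠ e) → Y i e ≠ 0 := by
    intro i e he
    obtain ⟨p, q, r, hpq, hpr, hqr, hip, hiq, hir⟩ : ∃ p q r : Fin 4, p ≠ q ∧ p ≠ r ∧ q ≠ r ∧
        i ≠ p ∧ i ≠ q ∧ i ≠ r := by
      clear he; revert i; decide
    exact hM.ne_zero (hY i) (hb.ne hpq) (hb.ne hpr) (hb.ne hqr) (h0 i p hip) (h0 i q hiq)
      (h0 i r hir) (he p hip).symm (he q hiq).symm (he r hir).symm
  set T : SignVector E := fun e => if h : ∃ i, b i = e then Y h.choose e else Y 0 e with hT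
  have hTb : ∀ i, T (b i) = Y i (b i) := by
    intro i
    have h : ∃ j, b j = b i := ⟨i, rfl⟩
    have h' : h.choose = i := hb h.choose_spec
    simp only [hT, dif_pos h, h']
  have hTn : ∀ e, (∀ j, b j ≠ e) → T e = Y 0 e := by
    intro e he
    have h : ¬ ∃ i, b i = e := fun ⟨i, hi⟩ => he i hi
    simp only [hT, dif_neg h]
  refine ⟨T, hb, fun e => ?_, fun i => ?_⟩
  · by_cases h : ∃ i, b i = e
    · obtain ⟨i, rfl⟩ := h
      rw [hTb]
      exact hne i _ fun j hij => hb.ne hij.symm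
    · have h' : ∀ j, b j ≠ e := fun j hj => h ⟨j, hj⟩
      rw [hTn e h']
      exact hne 0 e fun j _ => h' j
  · convert hY i using 1
    funext e
    by_cases h : ∃ j, b j = e
    · obtain ⟨j, rfl⟩ := h
      simp only [faceVector_apply hb, Finset.mem_singleton]
      split_ifs with hij
      · rw [hij, hTb]
      · rw [h0 i j (Ne.symm hij)]
    · have h' : ∀ j, b j ≠ e := fun j hj => h ⟨j, hj⟩
      rw [faceVector_of_forall_ne T (Finset.singleton_nonempty i) h', hTn e h', hagree i e h']

theorem IsUniformFour.exists_isSimplexAt_of_cocircuits (hM : M.IsUniformFour) {a b c d : E}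
    (hab : a ≠ b) (hac : a ≠ c) (had : a ≠ d) (hbc : b ≠ c) (hbd : b ≠ d) (hcd : c ≠ d)
    {Xa Xb Xc Xd : SignVector E} (hXa : Xa ∈ M.cocircuits) (hXb : Xb ∈ M.cocircuits)
    (hXc : Xc ∈ M.cocircuits) (hXd : Xd ∈ M.cocircuits)
    (ha : Xa b = 0 ∧ Xa c = 0 ∧ Xa d = 0) (hb : Xb a = 0 ∧ Xb c = 0 ∧ Xb d = 0)
    (hc : Xc a = 0 ∧ Xc b = 0 ∧ Xc d = 0) (hd : Xd a = 0 ∧ Xd b = 0 ∧ Xd c = 0)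
    (h : ∀ e, e ≠ a → e ≠ b → e ≠ c → e ≠ d → Xb e = Xa e ∧ Xc e = Xa e ∧ Xd e = Xa e) :
    ∃ b T, IsSimplexAt M b T := by
  refine ⟨![a, b, c, d], hM.exists_isSimplexAt (Y := ![Xa, Xb, Xc, Xd]) ?_ ?_ ?_ ?_⟩
  · clear ha hb hc hd h
    intro i j hij
    fin_cases i <;> fin_cases j <;> simp_all
  · intro i
    fin_cases i
    exacts [hXa, hXb, hXc, hXd]
  · intro i j hij
    fin_cases i <;> fin_cases j
    exacts [absurd rfl hij, ha.1, ha.2.1, ha.2.2, hb.1, absurd rfl hij, hb.2.1, hb.2.2,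
      hc.1, hc.2.1, absurd rfl hij, hc.2.2, hd.1, hd.2.1, hd.2.2, absurd rfl hij]
  · intro i e he
    have h' := h e (he 0).symm (he 1).symm (he 2).symm (he 3).symm
    fin_cases i
    exacts [rfl, h'.1, h'.2.1, h'.2.2]

/-! ### Lexicographically extremal separating hyperplanes -/

/-- Among finitely many `K x`, one is maximal for the lexicographic order in which coordinates of
larger `pos` are more significant. -/
theorem exists_lex_max {ι V : Type*} [Finite ι] (pos : ι → ℕ) (hpos : Function.Injective pos)
    {S : Set V} (hS : S.Finite) (hne : S.Nonempty) (K : V → ι → SignType) :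
    ∃ x ∈ S, ∀ y ∈ S, ∀ i, (∀ j, pos i < pos j → K x j = K y j) → ¬ K x i < K y i := by
  let _ : LinearOrder ι := LinearOrder.lift' (fun i => OrderDual.toDual (pos i))
    (fun i j h => hpos (OrderDual.toDual.injective h))
  have hlt : ∀ i j : ι, j < i ↔ pos i < pos j := fun i j => Iff.rfl
  obtain ⟨x, hx, hmax⟩ := hS.exists_maximalFor (fun x => toLex (K x)) S hne
  refine ⟨x, hx, fun y hy i hi hlt' => ?_⟩
  have h1 : toLex (K x) < toLex (K y) := ⟨i, fun j hj => hi j ((hlt i j).1 hj), hlt'⟩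
  exact absurd (hmax hy h1.le) (not_le_of_gt h1)

/-- The parity of the number of zeros of `X` beyond `m` in the order given by `pos`, as a sign. -/
noncomputable def zeroParity [Fintype E] (pos : E → ℕ) (X : SignVector E) (m : E) : SignType :=
  ∏ t, if X t = 0 ∧ pos m < pos t then -1 else 1

theorem zeroParity_eq [Fintype E] (hM : M.IsUniformFour) (pos : E → ℕ) {X : SignVector E}
    (hX : X ∈ M.cocircuits) {a b c : E} (hab : a ≠ b) (hac : a ≠ c) (hbc : b ≠ c) (ha : X a = 0)
    (hb : X b = 0) (hc : X c = 0) {m : E} (hcm : pos c ≤ pos m) :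
    zeroParity pos X m =
      (if pos m < pos a then -1 else 1) * (if pos m < pos b then -1 else 1) := by
  classical
  have hz : ∀ t, X t = 0 → t = a ∨ t = b ∨ t = c := by
    intro t ht
    by_contra h
    simp only [not_or] at h
    exact hM.ne_zero hX hab hac hbc ha hb hc h.1 h.2.1 h.2.2 ht
  rw [zeroParity, ← Finset.prod_subset (Finset.subset_univ {a, b})]
  · rw [Finset.prod_pair hab]
    simp [ha, hb]
  · intro t _ ht
    simp only [Finset.mem_insert, Finset.mem_singleton, not_or] at ht
    rw [if_neg]
    rintro ⟨h1, h2⟩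
    rcases hz t h1 with rfl | rfl | rfl
    · exact ht.1 rfl
    · exact ht.2 rfl
    · omega

/-- Let `X` be a hyperplane that separates `f` from `g` and is, among all of these, extremal in
the lexicographic order of its signs twisted by `zeroParity`. Then no hyperplane is met when `X`
is rotated towards `f` about two of its elements `a` and `b`: the hyperplane `W` through `a`, `b`
and `f` has all other elements on the same side as `-X`. -/
theorem IsSweepOrder.no_crossing [Fintype E] (hP : M.IsMatroidPolytope) (hM : M.IsUniformFour)
    {f g : E} {pos : E → ℕ} (ho : IsSweepOrder M f g pos) (hfg : f ≠ g) {X : SignVector E}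
    (hX : X ∈ M.cocircuits) (hXf : X f = 1) (hXg : X g = -1)
    (hmax : ∀ Y ∈ M.cocircuits, Y f = 1 → Y g = -1 → ∀ i, i ≠ f → i ≠ g →
      (∀ j, j ≠ f → j ≠ g → pos i < pos j →
        -(zeroParity pos X j * X j) = -(zeroParity pos Y j * Y j)) →
      ¬ -(zeroParity pos X i * X i) < -(zeroParity pos Y i * Y i))
    {a b x : E} (hab : a ≠ b) (hax : a ≠ x) (hbx : b ≠ x) (hXa : X a = 0) (hXb : X b = 0)
    (hXx : X x = 0) {W : SignVector E} (hW : W ∈ M.cocircuits) (hWa : W a = 0) (hWb : W b = 0)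
    (hWf : W f = 0) (hWg : W g = 1) {s : E} (hs : X s = W s) : X s = 0 := by
  classical
  by_contra hXs
  have ne_of : ∀ x, X x = 0 → x ≠ f ∧ x ≠ g := by
    intro x hx
    constructor <;> rintro rfl
    · rw [hx] at hXf; exact absurd hXf (by decide)
    · rw [hx] at hXg; exact absurd hXg (by decide)
  obtain ⟨haf, hag⟩ := ne_of a hXa
  obtain ⟨hbf, hbg⟩ := ne_of b hXb
  obtain ⟨hxf, hxg⟩ := ne_of x hXx
  have hsf : s ≠ f := by
    rintro rfl
    rw [hXf, hWf] at hs; exact absurd hs (by decide)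
  have hsg : s ≠ g := by
    rintro rfl
    rw [hXg, hWg] at hs; exact absurd hs (by decide)
  have hsa : a ≠ s := by
    rintro rfl
    exact hXs hXa
  have hsb : b ≠ s := by
    rintro rfl
    exact hXs hXb
  -- The hyperplane through `a`, `b`, `s` also separates `f` from `g`, and is closer to `f`.
  obtain ⟨Z, hZ, hZs, hZm⟩ := exists_elimination hX (M.neg_mem W hW) (e := s) (by
    intro h
    rw [neg_neg] at h
    rw [h, hWf] at hXf
    exact absurd hXf (by decide)) (by simpa using hs) hXs
  simp only [Pi.neg_apply] at hZm
  have hZa : Z a = 0 := by simpa [hXa, hWa] using hZm a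
  have hZb : Z b = 0 := by simpa [hXb, hWb] using hZm b
  have hZn : ∀ m, m ≠ a → m ≠ b → m ≠ s → Z m ≠ 0 := fun m =>
    hM.ne_zero hZ hab hsa hsb hZa hZb hZs
  have hXn : ∀ m, m ≠ a → m ≠ b → m ≠ x → X m ≠ 0 := fun m =>
    hM.ne_zero hX hab hax hbx hXa hXb hXx
  have hWn : ∀ m, m ≠ a → m ≠ b → m ≠ f → W m ≠ 0 := fun m =>
    hM.ne_zero hW hab haf hbf hWa hWb hWf
  have hZf : Z f = 1 := by
    have := hZn f haf.symm hbf.symm hsf.symm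
    simpa [hXf, hWf, this] using hZm f
  have hZg : Z g = -1 := by
    have := hZn g hag.symm hbg.symm hsg.symm
    simpa [hXg, hWg, this] using hZm g
  -- `i` is the last element at which `X` and `Z` differ.
  obtain ⟨i, hi, himax⟩ := Finset.exists_max_image (Finset.univ.filter fun m => X m ≠ Z m) pos
    ⟨s, by simpa [hZs] using hXs⟩
  simp only [Finset.mem_filter, Finset.mem_univ, true_and] at hi himax
  have hif : i ≠ f := by
    rintro rfl
    exact hi (by rw [hXf, hZf])
  have hig : i ≠ g := by
    rintro rfl
    exact hi (by rw [hXg, hZg])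
  have hia : a ≠ i := by
    rintro rfl
    exact hi (by rw [hXa, hZa])
  have hib : b ≠ i := by
    rintro rfl
    exact hi (by rw [hXb, hZb])
  have hxs : x ≠ s := by
    rintro rfl
    exact hXs hXx
  have hsi : pos s ≤ pos i := himax s (by rw [hZs]; exact hXs)
  have hxi : pos x ≤ pos i := himax x (by rw [hXx]; exact (hZn x hax.symm hbx.symm hxs).symm)
  have hpar : ∀ m, pos i ≤ pos m → zeroParity pos X m = zeroParity pos Z m := by
    intro m hm
    rw [zeroParity_eq hM pos hX hab hax hbx hXa hXb hXx (by omega),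
      zeroParity_eq hM pos hZ hab hsa hsb hZa hZb hZs (by omega)]
  refine hmax Z hZ hZf hZg i hif hig (fun j _ _ hj => ?_) ?_
  · have : X j = Z j := by
      by_contra h
      exact absurd (himax j h) (by omega)
    rw [hpar j hj.le, this]
  -- The hyperplane through `a`, `b`, `i` separates `f` from `g`.
  obtain ⟨V, hV, hVa, hVb, hVi, hVf, hVg⟩ : ∃ V ∈ M.cocircuits, V a = 0 ∧ V b = 0 ∧ V i = 0 ∧
      V f = 1 ∧ V g = -1 := by
    by_cases h1 : X i = 0
    · exact ⟨X, hX, hXa, hXb, h1, hXf, hXg⟩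
    by_cases h2 : Z i = 0
    · exact ⟨Z, hZ, hZa, hZb, h2, hZf, hZg⟩
    obtain ⟨V, hV, hVi, hVm⟩ := exists_elimination hX hZ (e := i) (by
      intro h
      rw [h, Pi.neg_apply, hZf] at hXf
      exact absurd hXf (by decide)) (SignType.eq_neg_of_ne h1 h2 hi) h1
    have hVa : V a = 0 := by simpa [hXa, hZa] using hVm a
    have hVb : V b = 0 := by simpa [hXb, hZb] using hVm b
    refine ⟨V, hV, hVa, hVb, hVi, ?_, ?_⟩
    · have := hM.ne_zero hV hab hia hib hVa hVb hVi haf.symm hbf.symm hif.symm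
      simpa [hXf, hZf, this] using hVm f
    · have := hM.ne_zero hV hab hia hib hVa hVb hVi hag.symm hbg.symm hig.symm
      simpa [hXg, hZg, this] using hVm g
  have hWi := ho.sign_eq hP hM hfg hab hia hib hV hW hVa hVb hVi hVf hVg hWa hWb hWf hWg
  rw [← hpar i le_rfl, zeroParity_eq hM pos hX hab hax hbx hXa hXb hXx hxi, ← hWi]
  have hWi0 := hWn i hia.symm hib.symm hif
  have hZi := hZm i
  by_cases his : i = s
  · subst his
    rw [hZs, ← hs]
    revert hXs
    generalize X i = p
    revert p; decide
  have hZi0 := hZn i hia.symm hib.symm his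
  have h1 : Z i = -W i := by
    rcases hZi with h | h | h
    · exact absurd h hZi0
    · exact absurd h.symm hi
    · exact h
  rw [h1] at hi ⊢
  revert hi hWi0
  generalize X i = p; generalize W i = q
  revert p q; decide

/-- The extremal hyperplane `X` separating `f` from `g`, through `a`, `b`, `c` say, forms a simplex
with the hyperplanes through `f` and two of `a`, `b`, `c`. -/
theorem IsSweepOrder.exists_isSimplexAt [Finite E] (hP : M.IsMatroidPolytope)
    (hM : M.IsUniformFour) {f g : E} {pos : E → ℕ} (ho : IsSweepOrder M f g pos) (hfg : f ≠ g)
    (hne : ∃ X ∈ M.cocircuits, X f = 1 ∧ X g = -1) : ∃ b T, IsSimplexAt M b T := by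
  classical
  have := Fintype.ofFinite E
  obtain ⟨X, ⟨hX, hXf, hXg⟩, hmax⟩ := exists_lex_max (ι := {e : E // e ≠ f ∧ e ≠ g})
    (fun e => pos e) (fun p q h => Subtype.ext (ho.inj p q p.2.1 p.2.2 q.2.1 q.2.2 h))
    (S := {X | X ∈ M.cocircuits ∧ X f = 1 ∧ X g = -1}) (Set.toFinite _) hne
    (fun X e => -(zeroParity pos X e * X e))
  obtain ⟨a, b, c, hab, hac, hbc, hz⟩ := Set.ncard_eq_three.1 (hM.ncard_zeroSet X hX)
  have hz' : ∀ m, X m = 0 ↔ m = a ∨ m = b ∨ m = c := fun m => by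
    have := Set.ext_iff.1 hz m
    simpa [SignVector.zeroSet] using this
  have ne_of : ∀ x, X x = 0 → x ≠ f ∧ x ≠ g := by
    intro x hx
    constructor <;> rintro rfl
    · rw [hx] at hXf; exact absurd hXf (by decide)
    · rw [hx] at hXg; exact absurd hXg (by decide)
  have hXa : X a = 0 := by simp [hz']
  have hXb : X b = 0 := by simp [hz']
  have hXc : X c = 0 := by simp [hz']
  -- The other three vertices of the simplex.
  have vertex : ∀ p q r, p ≠ q → p ≠ r → q ≠ r → X p = 0 → X q = 0 → X r = 0 →
      ∃ Y ∈ M.cocircuits, Y p = 0 ∧ Y q = 0 ∧ Y f = 0 ∧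
        ∀ e, e ≠ p → e ≠ q → e ≠ r → e ≠ f → Y e = X e := by
    intro p q r hpq hpr hqr hp hq hr
    obtain ⟨W, hW, hWp, hWq, hWf, hWg⟩ := hM.exists_normalized hpq (ne_of p hp).1 (ne_of q hq).1
      (ne_of p hp).2.symm (ne_of q hq).2.symm hfg.symm
    refine ⟨-W, M.neg_mem W hW, by simp [hWp], by simp [hWq], by simp [hWf], ?_⟩
    intro e hep heq her hef
    have h1 := hM.ne_zero hX hpq hpr hqr hp hq hr hep heq her
    have h2 := hM.ne_zero hW hpq (ne_of p hp).1 (ne_of q hq).1 hWp hWq hWf hep heq hef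
    have h3 : X e ≠ W e := fun h => h1 (ho.no_crossing hP hM hfg hX hXf hXg
      (fun Y hY hYf hYg i hif hig hj => hmax Y ⟨hY, hYf, hYg⟩ ⟨i, hif, hig⟩
        (fun j hij => hj j j.2.1 j.2.2 hij)) hpq hpr hqr hp hq hr hW hWp hWq hWf hWg h)
    rw [SignType.eq_neg_of_ne h1 h2 h3, Pi.neg_apply]
  obtain ⟨Ya, hYa, hYab, hYac, hYaf, hYae⟩ := vertex b c a hbc hab.symm hac.symm hXb hXc hXa
  obtain ⟨Yb, hYb, hYba, hYbc, hYbf, hYbe⟩ := vertex a c b hac hab hbc.symm hXa hXc hXb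
  obtain ⟨Yc, hYc, hYca, hYcb, hYcf, hYce⟩ := vertex a b c hab hac hbc hXa hXb hXc
  exact hM.exists_isSimplexAt_of_cocircuits (ne_of a hXa).1.symm (ne_of b hXb).1.symm
    (ne_of c hXc).1.symm hab hac hbc hX hYa hYb hYc ⟨hXa, hXb, hXc⟩ ⟨hYaf, hYab, hYac⟩
    ⟨hYbf, hYba, hYbc⟩ ⟨hYcf, hYca, hYcb⟩ fun e h0 h1 h2 h3 =>
      ⟨hYae e h2 h3 h1 h0, hYbe e h1 h3 h2 h0, hYce e h1 h2 h3 h0⟩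

/-! ### Existence of a simplex -/

/-- On four elements every region is a simplex. -/
theorem IsUniformFour.exists_isSimplexAt_of_four (hM : M.IsUniformFour) {a b c d : E}
    (hab : a ≠ b) (hac : a ≠ c) (had : a ≠ d) (hbc : b ≠ c) (hbd : b ≠ d) (hcd : c ≠ d)
    (hE : ∀ e, e = a ∨ e = b ∨ e = c ∨ e = d) : ∃ b T, IsSimplexAt M b T := by
  obtain ⟨Xa, hXa, a1, a2, a3⟩ := hM.exists_vanishing b c d hbc
  obtain ⟨Xb, hXb, b1, b2, b3⟩ := hM.exists_vanishing a c d hac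
  obtain ⟨Xc, hXc, c1, c2, c3⟩ := hM.exists_vanishing a b d hab
  obtain ⟨Xd, hXd, d1, d2, d3⟩ := hM.exists_vanishing a b c hab
  refine hM.exists_isSimplexAt_of_cocircuits hab hac had hbc hbd hcd hXa hXb hXc hXd
    ⟨a1, a2, a3⟩ ⟨b1, b2, b3⟩ ⟨c1, c2, c3⟩ ⟨d1, d2, d3⟩ fun e h1 h2 h3 h4 => ?_
  rcases hE e with h | h | h | h
  exacts [absurd h h1, absurd h h2, absurd h h3, absurd h h4]

theorem IsMatroidPolytope.exists_isSimplexAt [Finite E] (hP : M.IsMatroidPolytope)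
    (hM : M.IsUniformFour) (hne : Nontrivial E) : ∃ b T, IsSimplexAt M b T := by
  obtain ⟨e, e', hee⟩ := hne
  obtain ⟨V, hV, a, b, c, hab, hac, hbc, hVa, hVb, hVc, hpos⟩ := hP.exists_facet hM e e' hee
  obtain ⟨x, hx⟩ : ∃ x, V x ≠ 0 := by
    by_contra h
    push Not at h
    exact M.zero_notMem ((funext h : V = 0) ▸ hV)
  have hax : a ≠ x := by
    rintro rfl
    exact hx hVa
  have hbx : b ≠ x := by
    rintro rfl
    exact hx hVb
  have hcx : c ≠ x := by
    rintro rfl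
    exact hx hVc
  by_cases hE : ∀ e, e = a ∨ e = b ∨ e = c ∨ e = x
  · exact hM.exists_isSimplexAt_of_four hab hac hax hbc hbx hcx hE
  push Not at hE
  obtain ⟨y, hya, hyb, hyc, hyx⟩ := hE
  obtain ⟨f, g, h, hfg, hfh, hgh, hm, hsep⟩ := hM.exists_separating hab hac hbc hax hya.symm hbx
    hyb.symm hcx hyc.symm hyx.symm
  have hz : ∀ m, m = f ∨ m = g ∨ m = h → V m = 0 := by
    intro m h'
    rcases (hm m).1 h' with rfl | rfl | rfl <;> assumption
  obtain ⟨pos, ho⟩ := hM.exists_isSweepOrder hV hfg hfh hgh (hz f (by simp)) (hz g (by simp))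
    (hz h (by simp)) (fun m h1 h2 h3 => by
      have := (not_congr (hm m)).1 (by tauto)
      exact hpos m (by tauto) (by tauto) (by tauto))
  exact ho.exists_isSimplexAt hP hM hfg hsep

/-! ### Faces of a simplex -/

namespace IsSimplexAt

theorem faceVector_mem {b : Fin 4 → E} {T : SignVector E} (h : IsSimplexAt M b T)
    (s : Finset (Fin 4)) : faceVector b T s ∈ M.covectors := by
  induction s using Finset.induction_on with
  | empty => exact faceVector_empty b T ▸ zero_mem_covectors
  | insert i s hi ih =>
    convert comp_mem_covectors (h.vertex i) ih using 1
    funext e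
    by_cases he : ∃ j, b j = e
    · obtain ⟨j, rfl⟩ := he
      have hT := h.ne_zero (b j)
      simp only [SignVector.comp, faceVector_apply h.inj, Finset.mem_insert, Finset.mem_singleton]
      by_cases hji : j = i <;> simp_all
    · have he' : ∀ j, b j ≠ e := fun j hj => he ⟨j, hj⟩
      simp [SignVector.comp, faceVector_of_forall_ne T (Finset.singleton_nonempty i) he',
        faceVector_of_forall_ne T (Finset.insert_nonempty i s) he', h.ne_zero e]

theorem conforms_of_subset {b : Fin 4 → E} (T : SignVector E) {s t : Finset (Fin 4)}
    (hst : s ⊆ t) : SignVector.Conforms (faceVector b T s) (faceVector b T t) := by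
  intro e
  by_cases h1 : s = ∅ ∨ ∃ j, j ∉ s ∧ b j = e
  · exact Or.inr (if_pos h1)
  · left
    have h2 : ¬ (t = ∅ ∨ ∃ j, j ∉ t ∧ b j = e) := by
      rintro (rfl | ⟨j, hj, hje⟩)
      · exact h1 (Or.inl (Finset.subset_empty.1 hst))
      · exact h1 (Or.inr ⟨j, fun hjs => hj (hst hjs), hje⟩)
    rw [faceVector, faceVector, if_neg h1, if_neg h2]

theorem faceVector_conforms (b : Fin 4 → E) (T : SignVector E) (s : Finset (Fin 4)) :
    SignVector.Conforms (faceVector b T s) T := by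
  intro e
  rw [faceVector]
  split_ifs <;> simp

theorem faceVector_univ (b : Fin 4 → E) (T : SignVector E) : faceVector b T Finset.univ = T := by
  funext e
  simp [faceVector, Finset.univ_eq_empty_iff]

/-- The covectors below `T` are the face vectors: a face of the simplex contained in the
hyperplane of an element other than the `b i` would contain all four vertices or none, since the
circuit through the `b i` and that element has all vertices on the same side. -/
theorem eq_faceVector {b : Fin 4 → E} {T : SignVector E} (h : IsSimplexAt M b T)
    (hM : M.IsUniformFour) {Z : SignVector E} (hZ : Z ∈ M.covectors)
    (hZT : SignVector.Conforms Z T) :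
    Z = faceVector b T (Finset.univ.filter fun i => Z (b i) ≠ 0) := by
  classical
  by_cases hZ0 : Z = 0
  · subst hZ0
    simp [faceVector_empty]
  obtain ⟨Y, hY, hYZ⟩ := exists_cocircuit_conforms hZ hZ0
  obtain ⟨k, hk⟩ : ∃ i, Z (b i) ≠ 0 := by
    by_contra hc
    push Not at hc
    have h0 : ∀ i, Y (b i) = 0 := fun i => by
      rcases hYZ (b i) with h' | h'
      · rw [← h', hc i]
      · exact h'
    exact hM.ne_zero hY (h.inj.ne (show (0 : Fin 4) ≠ 1 by decide))
      (h.inj.ne (show (0 : Fin 4) ≠ 2 by decide)) (h.inj.ne (show (1 : Fin 4) ≠ 2 by decide))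
      (h0 0) (h0 1) (h0 2) (h.inj.ne (show (3 : Fin 4) ≠ 0 by decide))
      (h.inj.ne (show (3 : Fin 4) ≠ 1 by decide)) (h.inj.ne (show (3 : Fin 4) ≠ 2 by decide)) (h0 3)
  funext e
  by_cases he : ∃ j, b j = e
  · obtain ⟨j, rfl⟩ := he
    rw [faceVector_apply h.inj]
    simp only [Finset.mem_filter, Finset.mem_univ, true_and]
    split_ifs with hj
    · exact ((hZT (b j)).resolve_right hj).symm
    · exact not_not.1 hj
  have he' : ∀ j, b j ≠ e := fun j hj => he ⟨j, hj⟩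
  rw [faceVector_of_forall_ne T ⟨k, by simpa using hk⟩ he']
  by_contra hne
  have hZe : Z e = 0 := (hZT e).resolve_left fun h' => hne h'.symm
  obtain ⟨C, hsupp, hC⟩ := hM.exists_circuit (S := insert e (Finset.univ.image b)) (by
    rw [Finset.card_insert_of_notMem (by simpa using he'), Finset.card_image_of_injective _ h.inj]
    simp)
  simp only [Finset.mem_insert, Finset.mem_image, Finset.mem_univ, true_and] at hsupp
  have hTe := h.ne_zero e
  have hCe : C e ≠ 0 := (hsupp e).2 (Or.inl rfl)
  have hs : ∀ i, T (b i) * C (b i) = -(T e * C e) := by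
    intro i
    have h1 := (hC _ (h.faceVector_mem {i})).eq_neg (p := b i) (q := e) (by
      intro m hmi hme
      by_cases hm : C m = 0
      · exact Or.inr hm
      rcases (hsupp m).1 hm with rfl | ⟨j, rfl⟩
      · exact absurd rfl hme
      · left
        rw [faceVector_apply h.inj, if_neg]
        rw [Finset.mem_singleton]
        rintro rfl
        exact hmi rfl)
    rwa [faceVector_apply h.inj, if_pos (Finset.mem_singleton_self i),
      faceVector_of_forall_ne T (Finset.singleton_nonempty i) he'] at h1
  have hs' : ∀ m, Z m * C m = 0 ∨ Z m * C m = -(T e * C e) := by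
    intro m
    by_cases hm : C m = 0
    · left; rw [hm, mul_zero]
    rcases (hsupp m).1 hm with rfl | ⟨j, rfl⟩
    · left; rw [hZe, zero_mul]
    · rcases hZT (b j) with h' | h'
      · right; rw [← h', hs]
      · left; rw [h', zero_mul]
  rcases hC Z hZ with h' | ⟨⟨m, hm⟩, m', hm'⟩
  · exact hk ((mul_eq_zero.1 (h' (b k))).resolve_right ((hsupp _).2 (Or.inr ⟨k, rfl⟩)))
  · have h1 := hs' m
    have h2 := hs' m'
    rw [hm] at h1
    rw [hm'] at h2
    generalize -(T e * C e) = x at h1 h2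
    revert x; decide

theorem isTope {b : Fin 4 → E} {T : SignVector E} (h : IsSimplexAt M b T) : M.IsTope T := by
  refine ⟨faceVector_univ b T ▸ h.faceVector_mem Finset.univ, fun X _ hTX => ?_⟩
  funext e
  exact (hTX e).resolve_right (h.ne_zero e)

theorem filter_faceVector {b : Fin 4 → E} {T : SignVector E} (h : IsSimplexAt M b T)
    (s : Finset (Fin 4)) : (Finset.univ.filter fun i => faceVector b T s (b i) ≠ 0) = s := by
  ext i
  simp [faceVector_apply h.inj, h.ne_zero]

theorem isSimplicialTope {b : Fin 4 → E} {T : SignVector E} (h : IsSimplexAt M b T)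
    (hM : M.IsUniformFour) (hrank : M.rank = 4) : M.IsSimplicialTope T := by
  refine ⟨h.isTope, ?_⟩
  suffices ∀ r, r = 4 → Nonempty ((fun Y Z : {Y : SignVector E // Y ∈ M.covectors ∧ Y.Conforms T} =>
      Y.1.Conforms Z.1) ≃r (fun s t : Finset (Fin r) => s ⊆ t)) from this _ hrank
  rintro _ rfl
  refine ⟨⟨⟨fun Y => Finset.univ.filter fun i => Y.1 (b i) ≠ 0,
    fun s => ⟨faceVector b T s, h.faceVector_mem s, faceVector_conforms b T s⟩, ?_, ?_⟩, ?_⟩⟩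
  · intro Y
    exact Subtype.ext (h.eq_faceVector hM Y.2.1 Y.2.2).symm
  · exact h.filter_faceVector
  · intro Y Z
    constructor
    · intro hYZ
      rw [h.eq_faceVector hM Y.2.1 Y.2.2, h.eq_faceVector hM Z.2.1 Z.2.2]
      exact conforms_of_subset T hYZ
    · intro hYZ i hi
      simp only [Equiv.coe_fn_mk, Finset.mem_filter, Finset.mem_univ, true_and] at hi ⊢
      rw [(hYZ (b i)).resolve_right hi]
      exact hi

theorem hasChain_restrict {b : Fin 4 → E} {T : SignVector E} (h : IsSimplexAt M b T) {A : Set E}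
    {s : Finset (Fin 4)} (hs : ∀ i ∈ s, b i ∈ A) :
    SignVector.HasChain (M.restrictCovectors A) s.card := by
  have hl : s.toList.length = s.card := Finset.length_toList s
  have hnd := s.nodup_toList
  refine ⟨fun k (a : A) => faceVector b T (s.toList.take k).toFinset a, ?_, ?_, ?_⟩
  · funext a
    simp [faceVector_empty]
  · intro k _
    exact ⟨_, h.faceVector_mem _, rfl⟩
  · intro k hk
    have hk' : k < s.toList.length := hl.symm ▸ hk
    have htake : s.toList.take (k + 1) = s.toList.take k ++ [s.toList[k]] :=
      List.take_succ_eq_append_getElem hk'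
    have hnot : s.toList[k] ∉ s.toList.take k := by
      intro hmem
      have h1 : (s.toList.take (k + 1)).Nodup := hnd.sublist (List.take_sublist _ _)
      rw [htake, List.nodup_append] at h1
      exact h1.2.2 _ hmem _ (by simp) rfl
    constructor
    · intro a
      refine conforms_of_subset (b := b) T (fun i hi => ?_) a.1
      rw [List.mem_toFinset] at hi ⊢
      rw [htake]
      exact List.mem_append_left _ hi
    · intro heq
      have h1 := congrFun heq ⟨b s.toList[k], hs _ (by
        rw [← Finset.mem_toList]
        exact List.getElem_mem hk')⟩
      simp only [faceVector_apply h.inj, List.mem_toFinset] at h1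
      have hmem : s.toList[k] ∈ s.toList.take (k + 1) := htake ▸ List.mem_append_right _ (by simp)
      rw [if_neg hnot, if_pos hmem] at h1
      exact h.ne_zero _ h1.symm

theorem rankOn_image [Finite E] {b : Fin 4 → E} {T : SignVector E} (h : IsSimplexAt M b T)
    (s : Finset (Fin 4)) : M.rankOn (b '' s) = s.card := by
  apply le_antisymm
  · refine csSup_le ⟨_, h.hasChain_restrict (s := s) fun i hi => ⟨i, hi, rfl⟩⟩ fun k hk => ?_
    refine hk.le_card.trans_eq ?_
    rw [Nat.card_coe_set_eq, Set.ncard_image_of_injective _ h.inj, Set.ncard_coe_finset]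
  · exact (h.hasChain_restrict (A := b '' s) (s := s) fun i hi => ⟨i, hi, rfl⟩).le_chainRank

/-- If the all-positive vector is a simplex region, then its faces of rank `k` are given by the
`k`-subsets of its four bounding elements. -/
theorem ncard_isFace_rankOn [Finite E] {b : Fin 4 → E} (h : IsSimplexAt M b 1)
    (hM : M.IsUniformFour) {k : ℕ} (hk : k < 4) :
    {A : Set E | M.IsFace A ∧ M.rankOn A = k}.ncard = Nat.choose 4 k := by
  classical
  have hinj : Function.Injective fun s : Finset (Fin 4) => b '' (s : Set (Fin 4)) :=
    fun s t hst => Finset.coe_injective (h.inj.image_injective hst)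
  have key : {A : Set E | M.IsFace A ∧ M.rankOn A = k} =
      (fun s : Finset (Fin 4) => b '' (s : Set (Fin 4))) ''
        (Finset.powersetCard k (Finset.univ : Finset (Fin 4)) : Set (Finset (Fin 4))) := by
    ext A
    simp only [Set.mem_ofPred_eq, Set.mem_image, Finset.mem_coe, Finset.mem_powersetCard,
      Finset.subset_univ, true_and]
    constructor
    · rintro ⟨⟨X, hX, hXA⟩, hr⟩
      have hA : ∀ e, e ∈ A ↔ X e = 0 := fun e => ⟨(hXA e).1, fun h0 => by
        by_contra he
        rw [(hXA e).2 he] at h0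
        exact absurd h0 (by decide)⟩
      have hX1 := h.eq_faceVector hM hX fun e => by
        by_cases he : e ∈ A
        · exact Or.inr ((hXA e).1 he)
        · exact Or.inl ((hXA e).2 he).symm
      set s := Finset.univ.filter fun i => X (b i) ≠ 0 with hs
      have hAs : s.Nonempty → A = b '' ((sᶜ : Finset (Fin 4)) : Set (Fin 4)) := by
        intro hne
        ext e
        rw [hA, hX1, faceVector]
        simp [hne.ne_empty]
      rcases s.eq_empty_or_nonempty with hse | hne
      · -- The zero vector corresponds to the face consisting of all elements, of rank four.
        exfalso
        rw [hse, faceVector_empty] at hX1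
        have h4 := (h.hasChain_restrict (A := A) (s := Finset.univ) fun i _ => by
          rw [hA, hX1]; rfl).le_chainRank
        rw [Finset.card_univ, Fintype.card_fin] at h4
        change 4 ≤ M.rankOn A at h4
        omega
      · refine ⟨sᶜ, ?_, (hAs hne).symm⟩
        rw [← hr, hAs hne, h.rankOn_image]
    · rintro ⟨t, ht, rfl⟩
      refine ⟨⟨faceVector b 1 tᶜ, h.faceVector_mem _, fun e => ⟨?_, fun he => ?_⟩⟩, ?_⟩
      · rintro ⟨i, hi, rfl⟩
        rw [faceVector_apply h.inj, if_neg (by simpa using hi)]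
      · have hne : tᶜ ≠ ∅ := by
          intro h0
          have := Finset.card_compl t
          rw [h0, Fintype.card_fin, ht, Finset.card_empty] at this
          omega
        rw [faceVector, if_neg]
        · rfl
        · rintro (h0 | ⟨j, hj, rfl⟩)
          · exact hne h0
          · exact he ⟨j, by simpa using hj, rfl⟩
      · rw [h.rankOn_image, ht]
  rw [key, Set.ncard_image_of_injective _ hinj, Set.ncard_coe_finset, Finset.card_powersetCard,
    Finset.card_univ, Fintype.card_fin]

end IsSimplexAt

/-! ### Reorientation -/

theorem mem_covectors_reorient {F : Set E} {X : SignVector E}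
    (hX : X ∈ (M.reorient F).covectors) : SignVector.reorient F X ∈ M.covectors := by
  obtain ⟨l, hl, rfl⟩ := hX
  induction l with
  | nil =>
    convert zero_mem_covectors (M := M) using 1
    funext e
    by_cases he : e ∈ F <;> simp [SignVector.reorient, he]
  | cons Y l ih =>
    convert comp_mem_covectors (M := M) (hl Y List.mem_cons_self)
      (ih fun Z hZ => hl Z (List.mem_cons_of_mem _ hZ)) using 1
    funext e
    by_cases he : e ∈ F <;> by_cases hY : Y e = 0 <;>
      simp [SignVector.reorient, SignVector.comp, he, hY]

theorem reorient_reorient (F : Set E) : (M.reorient F).reorient F = M := by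
  cases M
  simp [reorient, SignVector.reorient_reorient]

theorem hasChain_of_reorient {F : Set E} {k : ℕ}
    (h : SignVector.HasChain (M.reorient F).covectors k) : SignVector.HasChain M.covectors k := by
  obtain ⟨c, h0, hc, hs⟩ := h
  refine ⟨fun i => SignVector.reorient F (c i), ?_, fun i hi => mem_covectors_reorient (hc i hi),
    fun i hi => ⟨fun e => ?_, fun heq => (hs i hi).2 ?_⟩⟩
  · funext e
    by_cases he : e ∈ F <;> simp [SignVector.reorient, he, h0]
  · have := (hs i hi).1 e
    by_cases he : e ∈ F <;> simpa [SignVector.reorient, he] using this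
  · simpa [SignVector.reorient_reorient] using congrArg (SignVector.reorient F) heq

theorem rank_reorient (F : Set E) : (M.reorient F).rank = M.rank := by
  have : {k | SignVector.HasChain (M.reorient F).covectors k} =
      {k | SignVector.HasChain M.covectors k} := by
    ext k
    refine ⟨hasChain_of_reorient, fun h => ?_⟩
    rw [← reorient_reorient (M := M) F] at h
    exact hasChain_of_reorient h
  rw [rank, rank, SignVector.chainRank, SignVector.chainRank, this]

theorem IsUniformFour.reorient (hM : M.IsUniformFour) (F : Set E) :
    (M.reorient F).IsUniformFour := by
  refine ⟨fun X hX => ?_, fun a b c hab => ?_⟩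
  · rw [← SignVector.zeroSet_reorient F X]
    exact hM.ncard_zeroSet _ hX
  · obtain ⟨X, hX, ha, hb, hc⟩ := hM.exists_vanishing a b c hab
    have h0 : ∀ e, X e = 0 → SignVector.reorient F X e = 0 := by
      intro e he
      by_cases h : e ∈ F <;> simp [SignVector.reorient, h, he]
    refine ⟨SignVector.reorient F X, ?_, h0 a ha, h0 b hb, h0 c hc⟩
    change SignVector.reorient F (SignVector.reorient F X) ∈ M.cocircuits
    rwa [SignVector.reorient_reorient]

theorem IsSimplexAt.reorient {b : Fin 4 → E} {F : Set E}
    (h : IsSimplexAt M b (SignVector.ofNeg F)) : IsSimplexAt (M.reorient F) b 1 := by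
  refine ⟨h.inj, fun e => one_ne_zero, fun i => ?_⟩
  change SignVector.reorient F (faceVector b 1 {i}) ∈ M.cocircuits
  convert h.vertex i using 1
  funext e
  simp only [SignVector.reorient, SignVector.ofNeg, faceVector]
  split_ifs <;> simp

end OrientedMatroid

theorem mainTheorem3 {E : Type*} [Finite E] (M : OrientedMatroid E) (hrank : M.rank = 4)
    (huniform : M.IsUniform) (hpolytope : M.IsMatroidPolytope) :
    ∃ F : Set E,
      (M.reorient F).IsAcyclic ∧
      {A : Set E | (M.reorient F).IsExtremePoint A}.ncard = 4 ∧
      {A : Set E | (M.reorient F).IsFacet A}.ncard = 4 ∧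
      M.IsSimplicialTope (SignVector.ofNeg F) := by
  have hM := OrientedMatroid.isUniformFour_of_rank hrank huniform
  have hE : Nontrivial E := by
    by_contra h
    rw [not_nontrivial_iff_subsingleton] at h
    have h1 : M.rank ≤ Nat.card E := csSup_le
      ⟨0, fun _ => 0, rfl, fun _ _ => OrientedMatroid.zero_mem_covectors, fun i hi => by omega⟩
      fun k hk => hk.le_card
    have h2 : Nat.card E ≤ 1 := Finite.card_le_one_iff_subsingleton.2 h
    omega
  obtain ⟨b, T, h⟩ := hpolytope.exists_isSimplexAt hM hE
  have hT : T = SignVector.ofNeg {e | T e = -1} := by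
    funext e
    have := h.ne_zero e
    simp only [SignVector.ofNeg, Set.mem_ofPred_eq]
    split_ifs with h1
    · exact h1
    · revert this h1
      generalize T e = x
      revert x; decide
  generalize {e | T e = -1} = F at hT
  subst hT
  refine ⟨F, ?_, ?_, ?_, h.isSimplicialTope hM hrank⟩
  · exact h.reorient.isTope.1
  · exact h.reorient.ncard_isFace_rankOn (hM.reorient F) (k := 1) (by omega)
  · have := h.reorient.ncard_isFace_rankOn (hM.reorient F) (k := 3) (by omega)
    simpa [OrientedMatroid.IsFacet, OrientedMatroid.rank_reorient, hrank] using this
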